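/- Let $f_0,\rho_0\in C^\infty([0,1])$ satisfy $f_0(0)=f_0(1)=0$, $\rho_0(0)=\rho_0(1)=0$ and $\rho_0\ge 0$ on $[0,1]$. Let $M_0=\max_{x\in[0,1]}f_0'(x)$ and suppose that $M_0>0$, that $f_0'$ attains the value $M_0$ only at boundary points (one or both) $x_i^*\in\{0,1\}$, and that $f_0''(x_i^*)\neq 0$ at each of these points (derivatives at the endpoints are one-sided). Consider the initial boundary value problem $$ \begin{cases} f_{xt}+ff_{xx}-f_x^2+\rho=I(t), & x\in[0,1],\ t>0,\\ \rho_t+f\rho_x=\rho f_x, & x\in[0,1],\ t>0,\\ I(t)=\int_0^1\rho\,dx-2\int_0^1 f_x^2\,dx, & t>0,\\ f(0,x)=f_0(x),\quad \rho(0,x)=\rho_0(x), & x\in[0,1],\\ f(t,0)=f(t,1)=0,\quad \rho(t,0)=\rho(t,1)=0 . \end{cases} $$ By a classical solution on $[0,T)$ we mean a pair $(f,\rho)$ satisfying these relations for $t<T$, with $f,f_x,f_{xx},\rho,\rho_x$ continuous on $[0,T)\times[0,1]$ and such that $f_{xt},\rho_t$ exist for $0<t<T$. Then there is a finite $t^*>0$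 such that the problem has a classical solution $(f,\rho)$ on $[0,t^*)$; every classical solution on an interval $[0,T)$ has $T\le t^*$ and coincides with $(f,\rho)$ on $[0,T)\times[0,1]$; and, at every point $x_i^*$ where $f_0'(x_i^*)=M_0$, $$ \lim_{t\nearrow t^*}\int_0^t f_x(s,x_i^*)\,ds=+\infty . $$ Moreover the following limit exists and is finite, and $$ t^*\le \lim_{\eta\nearrow 1/M_0}\int_0^{\eta}\left(\int_0^1\frac{dx}{1-\mu f_0'(x)}\right)^{2}d\mu . $$ -/

import Mathlib

open Set Filter Topology MeasureTheory
open scoped ContDiff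

noncomputable section

/-- Derivative of a function of `x ∈ [0,1]`, one-sided at the two endpoints. -/
def dX (u : ℝ → ℝ) (x : ℝ) : ℝ := derivWithin u (Icc 0 1) x

/-- The nonlocal term `I(t) = ∫₀¹ ρ dx - 2 ∫₀¹ f_x² dx`, for the time slices
`u = f(t,·)` and `r = ρ(t,·)`. -/
def nonlocalI (u r : ℝ → ℝ) : ℝ :=
  (∫ x in (0 : ℝ)..1, r x) - 2 * ∫ x in (0 : ℝ)..1, (dX u x) ^ 2

/-- `(f, ρ)`, written `f t x` and `ρ t x`, is a classical solution on `[0,T) × [0,1]` of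

* `f_xt + f f_xx - f_x² + ρ = I(t)`,
* `ρ_t + f ρ_x = ρ f_x`,
* `I(t) = ∫₀¹ ρ dx - 2 ∫₀¹ f_x² dx`,

with initial data `(f₀, ρ₀)` and Dirichlet boundary conditions `f = ρ = 0` at `x = 0, 1`. The
functions `f, f_x, f_xx, ρ, ρ_x` are continuous on `[0,T) × [0,1]`, and `f_xt, ρ_t` exist for
`0 < t < T`. -/
structure IsDirichletSolution (f₀ ρ₀ : ℝ → ℝ) (T : ℝ) (f ρ : ℝ → ℝ → ℝ) : Prop where
  diff_f : ∀ t ∈ Ico 0 T, DifferentiableOn ℝ (f t) (Icc 0 1)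
  diff_fx : ∀ t ∈ Ico 0 T, DifferentiableOn ℝ (dX (f t)) (Icc 0 1)
  diff_rho : ∀ t ∈ Ico 0 T, DifferentiableOn ℝ (ρ t) (Icc 0 1)
  cont_f : ContinuousOn (fun p : ℝ × ℝ => f p.1 p.2) (Ico 0 T ×ˢ Icc 0 1)
  cont_fx : ContinuousOn (fun p : ℝ × ℝ => dX (f p.1) p.2) (Ico 0 T ×ˢ Icc 0 1)
  cont_fxx : ContinuousOn (fun p : ℝ × ℝ => dX (dX (f p.1)) p.2) (Ico 0 T ×ˢ Icc 0 1)
  cont_rho : ContinuousOn (fun p : ℝ × ℝ => ρ p.1 p.2) (Ico 0 T ×ˢ Icc 0 1)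
  cont_rhox : ContinuousOn (fun p : ℝ × ℝ => dX (ρ p.1) p.2) (Ico 0 T ×ˢ Icc 0 1)
  diff_t_fx : ∀ t ∈ Ioo 0 T, ∀ x ∈ Icc (0 : ℝ) 1, DifferentiableAt ℝ (fun s => dX (f s) x) t
  diff_t_rho : ∀ t ∈ Ioo 0 T, ∀ x ∈ Icc (0 : ℝ) 1, DifferentiableAt ℝ (fun s => ρ s x) t
  eq_f : ∀ t ∈ Ioo 0 T, ∀ x ∈ Icc (0 : ℝ) 1,
    deriv (fun s => dX (f s) x) t + f t x * dX (dX (f t)) x - (dX (f t) x) ^ 2 + ρ t x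
      = nonlocalI (f t) (ρ t)
  eq_rho : ∀ t ∈ Ioo 0 T, ∀ x ∈ Icc (0 : ℝ) 1,
    deriv (fun s => ρ s x) t + f t x * dX (ρ t) x = ρ t x * dX (f t) x
  init_f : ∀ x ∈ Icc (0 : ℝ) 1, f 0 x = f₀ x
  init_rho : ∀ x ∈ Icc (0 : ℝ) 1, ρ 0 x = ρ₀ x
  bdry_f : ∀ t ∈ Ico 0 T, f t 0 = 0 ∧ f t 1 = 0
  bdry_rho : ∀ t ∈ Ico 0 T, ρ t 0 = 0 ∧ ρ t 1 = 0

end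

/-!
Along the flow `γ` of `f`, the reciprocal Jacobian `W = 1 / γ_x` satisfies the linear equation
`W_tt + I(t) W = ρ₀`, and the boundary condition `γ(t,1) = 1` becomes the constraint
`∫₀¹ dx / W = 1`. Writing `W = φ(η) (1 - η f₀' + Q(η) ρ₀)` with the new time `dt = φ² dη` removes
the unknown `I`: the constraint gives `φ = ∫₀¹ dx / (1 - η f₀' + Q ρ₀)`, and what remains is the
scalar equation `Q'' = φ³`, `Q(0) = Q'(0) = 0`, solvable on all of `[0, 1/M₀)`.

Since `f₀'' ≠ 0` at the maxima of `f₀'`, which are endpoints, `M₀ - f₀' ≥ c x (1 - x)`, so `φ` grows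
more slowly than any power `(1 - η M₀)^(-q)`, `q > 0`. Hence `t* = ∫ φ² dη` over `[0, 1/M₀)` is
finite, and `Q ≥ 0` bounds it by the same integral with `Q = 0`. A maximum point `x*` is fixed by
the flow and `ρ₀(x*) = 0`, so there `W = φ (1 - η M₀) → 0` while `∫₀ᵗ f_x = -log W → ∞`, which also
prevents continuation. Uniqueness is a Gronwall estimate for the energy of the difference of two
solutions.
-/

section Calculus

variable {E : Type*} [NormedAddCommGroup E] {a b c : ℝ}

theorem uIcc_subset_Icc_of_mem (hc : c ∈ Icc a b) : uIcc a c ⊆ Icc a b :=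
  (uIcc_of_le hc.1).trans_subset (Icc_subset_Icc_right hc.2)

theorem intervalIntegrable_of_continuousOn_of_mem {h : ℝ → E} (hh : ContinuousOn h (Icc a b))
    (hc : c ∈ Icc a b) : IntervalIntegrable h volume a c :=
  (hh.mono (uIcc_subset_Icc_of_mem hc)).intervalIntegrable

variable [NormedSpace ℝ E]

theorem continuousOn_parametric_integral {α : Type*} [TopologicalSpace α]
    [FirstCountableTopology α] {S : Set α} {h : α → ℝ → E}
    (hh : ContinuousOn (fun p : α × ℝ => h p.1 p.2) (S ×ˢ Icc a b)) :
    ContinuousOn (fun p : α × ℝ => ∫ x in a..p.2, h p.1 x) (S ×ˢ Icc a b) := by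
  rcases (Icc a b).eq_empty_or_nonempty with hab | hab
  · simp [hab]
  have hab : a ≤ b := nonempty_Icc.1 hab
  have hproj : Continuous (Function.uncurry fun (q : ↥(S ×ˢ Icc a b)) (x : ℝ) =>
      h q.1.1 (projIcc a b hab x)) :=
    hh.comp_continuous (f := fun r : ↥(S ×ˢ Icc a b) × ℝ => (r.1.1.1, (projIcc a b hab r.2 : ℝ)))
      (by fun_prop) fun r => ⟨r.1.2.1, (projIcc a b hab r.2).2⟩
  rw [continuousOn_iff_continuous_domRestrict]
  refine (intervalIntegral.continuous_parametric_intervalIntegral_of_continuous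
    (μ := volume) (a₀ := a) hproj (s := fun q => q.1.2) (by fun_prop)).congr fun q => ?_
  refine intervalIntegral.integral_congr fun x hx => ?_
  simp only [projIcc_of_mem hab (uIcc_subset_Icc_of_mem q.2.2 hx)]

theorem continuousOn_parametric_integral_of_mem {α : Type*} [TopologicalSpace α]
    [FirstCountableTopology α] {S : Set α} {h : α → ℝ → E}
    (hh : ContinuousOn (fun p : α × ℝ => h p.1 p.2) (S ×ˢ Icc a b)) (hc : c ∈ Icc a b) :
    ContinuousOn (fun t => ∫ x in a..c, h t x) S :=
  ContinuousOn.uncurry_right (f := fun t c => ∫ x in a..c, h t x) c hc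
    (continuousOn_parametric_integral hh)

theorem hasDerivAt_parametric_integral {U : Set ℝ} (hU : IsOpen U) {h h' : ℝ → ℝ → E}
    (hh : ContinuousOn (fun p : ℝ × ℝ => h p.1 p.2) (U ×ˢ Icc a b))
    (hh' : ContinuousOn (fun p : ℝ × ℝ => h' p.1 p.2) (U ×ˢ Icc a b))
    (hd : ∀ t ∈ U, ∀ x ∈ Icc a b, HasDerivAt (fun s => h s x) (h' t x) t)
    {t : ℝ} (ht : t ∈ U) (hc : c ∈ Icc a b) :
    HasDerivAt (fun s => ∫ x in a..c, h s x) (∫ x in a..c, h' t x) t := by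
  obtain ⟨ε, hε, hsub⟩ := Metric.nhds_basis_closedBall.mem_iff.1 (hU.mem_nhds ht)
  obtain ⟨K, hK⟩ := ((isCompact_closedBall t ε).prod isCompact_Icc).exists_bound_of_continuousOn
    (hh'.mono (prod_mono_left hsub))
  have hunit : uIoc a c ⊆ Icc a b := uIoc_subset_uIcc.trans (uIcc_subset_Icc_of_mem hc)
  have hmeas : ∀ {k : ℝ → E}, ContinuousOn k (Icc a b) →
      AEStronglyMeasurable k (volume.restrict (uIoc a c)) := fun hk =>
    (hk.mono hunit).aestronglyMeasurable measurableSet_uIoc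
  exact (intervalIntegral.hasDerivAt_integral_of_dominated_loc_of_deriv_le
    (bound := fun _ => K) (Metric.closedBall_mem_nhds t hε)
    (by filter_upwards [hU.mem_nhds ht] with s hs using hmeas (hh.uncurry_left s hs))
    (intervalIntegrable_of_continuousOn_of_mem (hh.uncurry_left t ht) hc)
    (hmeas (hh'.uncurry_left t ht))
    (Eventually.of_forall fun x hx s hs => hK (s, x) ⟨hs, hunit hx⟩) intervalIntegrable_const
    (Eventually.of_forall fun x hx s hs => hd s (hsub hs) x (hunit hx))).2

variable [CompleteSpace E]

theorem hasDerivWithinAt_integral_Icc {h : ℝ → E} (hh : ContinuousOn h (Icc a b))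
    (hc : c ∈ Icc a b) :
    HasDerivWithinAt (fun x => ∫ z in a..x, h z) (h c) (Icc a b) c := by
  have : Fact (c ∈ Icc a b) := ⟨hc⟩
  exact intervalIntegral.integral_hasDerivWithinAt_right
    (intervalIntegrable_of_continuousOn_of_mem hh hc)
    (hh.stronglyMeasurableAtFilter_nhdsWithin measurableSet_Icc c) (hh c hc)

theorem hasDerivWithinAt_integral_Ico {h : ℝ → E} (hh : ContinuousOn h (Ico a b))
    (hc : c ∈ Ico a b) :
    HasDerivWithinAt (fun x => ∫ z in a..x, h z) (h c) (Ico a b) c := by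
  obtain ⟨c', hcc', hc'⟩ := exists_between hc.2
  refine (hasDerivWithinAt_integral_Icc (hh.mono (Icc_subset_Ico_right hc'))
    ⟨hc.1, hcc'.le⟩).mono_of_mem_nhdsWithin ?_
  filter_upwards [self_mem_nhdsWithin, mem_nhdsWithin_of_mem_nhds (Iio_mem_nhds hcc')]
    with z hz hz' using ⟨hz.1, le_of_lt hz'⟩

theorem integral_eq_sub_of_hasDerivWithinAt_Icc {u u' : ℝ → E}
    (hd : ∀ x ∈ Icc a b, HasDerivWithinAt u (u' x) (Icc a b) x)
    (hu' : ContinuousOn u' (Icc a b)) (hc : c ∈ Icc a b) :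
    ∫ x in a..c, u' x = u c - u a := by
  have hsub : Icc a c ⊆ Icc a b := Icc_subset_Icc_right hc.2
  refine intervalIntegral.integral_eq_sub_of_hasDerivAt_of_le hc.1
    (fun x hx => (hd x (hsub hx)).continuousWithinAt.mono hsub) (fun x hx => ?_)
    (intervalIntegrable_of_continuousOn_of_mem hu' hc)
  exact (hd x (hsub (Ioo_subset_Icc_self hx))).hasDerivAt
    (Icc_mem_nhds hx.1 (hx.2.trans_le hc.2))

end Calculus

section EnergyTools

variable {a b : ℝ}

theorem sq_integral_le_mul_integral_sq {u : ℝ → ℝ} (hab : a ≤ b) (hu : ContinuousOn u (Icc a b)) :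
    (∫ x in a..b, u x) ^ 2 ≤ (b - a) * ∫ x in a..b, u x ^ 2 := by
  rcases hab.eq_or_lt with rfl | hlt
  · simp
  have hl : 0 < b - a := sub_pos.2 hlt
  have hint : ∀ {v : ℝ → ℝ}, ContinuousOn v (Icc a b) → IntegrableOn v (uIoc a b) := fun hv =>
    (hv.integrableOn_Icc).mono_set (uIoc_of_le hab ▸ Ioc_subset_Icc_self)
  have hjensen := (even_two.convexOn_pow (𝕜 := ℝ)).map_set_average_le (t := uIoc a b)
    (μ := volume) (f := u) (by fun_prop) isClosed_univ (by simp [uIoc_of_le hab, hlt])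
    (by simp [uIoc_of_le hab]) (by simp) (hint hu) (hint (hu.pow 2))
  simp only [interval_average_eq, smul_eq_mul] at hjensen
  field_simp at hjensen
  exact hjensen

theorem sq_sub_le_mul_integral_sq_deriv {w u : ℝ → ℝ}
    (hw : ∀ x ∈ Icc a b, HasDerivWithinAt w (u x) (Icc a b) x) (hu : ContinuousOn u (Icc a b))
    {x : ℝ} (hx : x ∈ Icc a b) : (w x - w a) ^ 2 ≤ (b - a) * ∫ y in a..b, u y ^ 2 := by
  have hab : a ≤ b := hx.1.trans hx.2
  have hu2 : IntervalIntegrable (fun y => u y ^ 2) volume a b :=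
    (hu.pow 2).intervalIntegrable_of_Icc hab
  calc (w x - w a) ^ 2 = (∫ y in a..x, u y) ^ 2 := by
        rw [integral_eq_sub_of_hasDerivWithinAt_Icc hw hu hx]
    _ ≤ (x - a) * ∫ y in a..x, u y ^ 2 :=
        sq_integral_le_mul_integral_sq hx.1 (hu.mono (Icc_subset_Icc_right hx.2))
    _ ≤ (b - a) * ∫ y in a..b, u y ^ 2 := by
        refine mul_le_mul (sub_le_sub_right hx.2 a) ?_ ?_ (sub_nonneg.2 hab)
        · exact intervalIntegral.integral_mono_interval le_rfl hx.1 hx.2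
            (Eventually.of_forall fun _ => sq_nonneg _) hu2
        · exact intervalIntegral.integral_nonneg hx.1 fun _ _ => sq_nonneg _

theorem integral_deriv_mul_eq_zero {f f' e e' : ℝ → ℝ} (hab : a ≤ b)
    (hf : ∀ x ∈ Icc a b, HasDerivWithinAt f (f' x) (Icc a b) x)
    (he : ∀ x ∈ Icc a b, HasDerivWithinAt e (e' x) (Icc a b) x)
    (hf' : ContinuousOn f' (Icc a b)) (he' : ContinuousOn e' (Icc a b))
    (hfa : f a = 0) (hfb : f b = 0) : ∫ x in a..b, (f' x * e x + f x * e' x) = 0 := by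
  have cf : ContinuousOn f (Icc a b) := fun x hx => (hf x hx).continuousWithinAt
  have ce : ContinuousOn e (Icc a b) := fun x hx => (he x hx).continuousWithinAt
  rw [integral_eq_sub_of_hasDerivWithinAt_Icc (u := fun x => f x * e x)
    (fun x hx => (hf x hx).mul (he x hx)) (by fun_prop) (right_mem_Icc.2 hab), hfa, hfb]
  ring

theorem le_mul_exp_of_deriv_le_mul {C : ℝ} {E E' : ℝ → ℝ} (hc : ContinuousOn E (Icc a b))
    (hd : ∀ t ∈ Ioo a b, HasDerivAt E (E' t) t) (hle : ∀ t ∈ Ioo a b, E' t ≤ C * E t) {t : ℝ}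
    (ht : t ∈ Icc a b) : E t ≤ E a * Real.exp (C * (t - a)) := by
  have hder : ∀ s ∈ Ioo a b, HasDerivAt (fun s => E s * Real.exp (-(C * (s - a))))
      ((E' s - C * E s) * Real.exp (-(C * (s - a)))) s := fun s hs => by
    have hlin : HasDerivAt (fun s => -(C * (s - a))) (-(C * 1)) s :=
      (((hasDerivAt_id' s).sub_const a).const_mul C).neg
    exact ((hd s hs).mul hlin.exp).congr_deriv (by ring)
  have hanti : AntitoneOn (fun s => E s * Real.exp (-(C * (s - a)))) (Icc a b) := by
    refine antitoneOn_of_hasDerivWithinAt_nonpos (convex_Icc a b) (by fun_prop)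
      (f' := fun s => (E' s - C * E s) * Real.exp (-(C * (s - a)))) ?_ ?_ <;>
      rw [interior_Icc] <;> intro s hs
    · exact (hder s hs).hasDerivWithinAt
    · exact mul_nonpos_of_nonpos_of_nonneg (sub_nonpos.2 (hle s hs)) (Real.exp_pos _).le
  have h := hanti (left_mem_Icc.2 (ht.1.trans ht.2)) ht ht.1
  simp only [sub_self, mul_zero, neg_zero, Real.exp_zero, mul_one, Real.exp_neg] at h
  rwa [← div_eq_mul_inv, div_le_iff₀ (Real.exp_pos _)] at h

end EnergyTools

theorem dX_eq_of_hasDerivWithinAt {u : ℝ → ℝ} {u' x : ℝ}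
    (h : HasDerivWithinAt u u' (Icc 0 1) x) (hx : x ∈ Icc (0 : ℝ) 1) : dX u x = u' :=
  h.derivWithin (uniqueDiffOn_Icc zero_lt_one x hx)

theorem dX_congr {u v : ℝ → ℝ} (h : EqOn u v (Icc 0 1)) : EqOn (dX u) (dX v) (Icc 0 1) :=
  fun _ hx => derivWithin_congr h (h hx)

/-- Energy density of the difference of `(f, ρ)` and `(g, σ)`: `(f_x - g_x)² + (ρ - σ)²`. -/
noncomputable def energyDensity (f ρ g σ : ℝ → ℝ → ℝ) (t x : ℝ) : ℝ :=
  (dX (f t) x - dX (g t) x) ^ 2 + (ρ t x - σ t x) ^ 2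

/-- The spatial derivative of `energyDensity f ρ g σ`. -/
noncomputable def energyDensityX (f ρ g σ : ℝ → ℝ → ℝ) (t x : ℝ) : ℝ :=
  2 * (dX (f t) x - dX (g t) x) * (dX (dX (f t)) x - dX (dX (g t)) x)
    + 2 * (ρ t x - σ t x) * (dX (ρ t) x - dX (σ t) x)

/-- The time derivative of `energyDensity f ρ g σ` along two solutions of the system, with the
time derivatives replaced by means of the equations. -/
noncomputable def energyProduction (f ρ g σ : ℝ → ℝ → ℝ) (t x : ℝ) : ℝ :=
  2 * (dX (f t) x - dX (g t) x) * (-f t x * (dX (dX (f t)) x - dX (dX (g t)) x)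
      - (f t x - g t x) * dX (dX (g t)) x
      + (dX (f t) x + dX (g t) x) * (dX (f t) x - dX (g t) x) - (ρ t x - σ t x)
      + (nonlocalI (f t) (ρ t) - nonlocalI (g t) (σ t)))
    + 2 * (ρ t x - σ t x) * ((ρ t x - σ t x) * dX (f t) x + σ t x * (dX (f t) x - dX (g t) x)
      - f t x * (dX (ρ t) x - dX (σ t) x) - (f t x - g t x) * dX (σ t) x)

theorem energyDensity_nonneg (f ρ g σ : ℝ → ℝ → ℝ) (t x : ℝ) : 0 ≤ energyDensity f ρ g σ t x := by
  unfold energyDensity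
  positivity

/-- Here `-(f₁ * e + f * e')`, with `e = u ^ 2 + r ^ 2`, is a divergence, and `2 * J * u` is the
contribution of the nonlocal term. -/
theorem energy_production_pointwise_le {f f₁ u u₁ r r₁ w G σ σ₁ s J K E : ℝ} (hf₁ : |f₁| ≤ K)
    (hG : |G| ≤ K) (hσ : |σ| ≤ K) (hσ₁ : |σ₁| ≤ K) (hs : |s| ≤ 2 * K) (hw : w ^ 2 ≤ E) :
    2 * u * (-f * u₁ - w * G + s * u - r + J) + 2 * r * (r * f₁ + σ * u - f * r₁ - w * σ₁)
      ≤ 2 * J * u - (f₁ * (u ^ 2 + r ^ 2) + f * (2 * u * u₁ + 2 * r * r₁))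
        + ((10 * K + 1) * (u ^ 2 + r ^ 2) + 2 * K * E) := by
  have young : ∀ p q c : ℝ, |c| ≤ K → 2 * (p * q * c) ≤ K * (p ^ 2 + q ^ 2) := by
    intro p q c hc
    obtain ⟨hc₁, hc₂⟩ := abs_le.1 hc
    nlinarith [mul_nonneg (sub_nonneg.2 hc₂) (sq_nonneg (p + q)),
      mul_nonneg (neg_le_iff_add_nonneg.1 hc₁) (sq_nonneg (p - q))]
  have hK : 0 ≤ K := (abs_nonneg f₁).trans hf₁
  have hwuG := young (-w) u G hG
  have hurσ := young u r σ hσ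
  have hwrσ₁ := young (-w) r σ₁ hσ₁
  have hsu : s * u ^ 2 ≤ 2 * K * u ^ 2 :=
    mul_le_mul_of_nonneg_right (le_of_abs_le hs) (sq_nonneg u)
  have hf₁r : f₁ * r ^ 2 ≤ K * r ^ 2 := mul_le_mul_of_nonneg_right (le_of_abs_le hf₁) (sq_nonneg r)
  have hf₁u : f₁ * u ^ 2 ≤ K * u ^ 2 := mul_le_mul_of_nonneg_right (le_of_abs_le hf₁) (sq_nonneg u)
  have hKw := mul_le_mul_of_nonneg_left hw hK
  have hKr := mul_nonneg hK (sq_nonneg r)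
  nlinarith [sq_nonneg (u + r)]

namespace IsDirichletSolution

variable {f₀ ρ₀ : ℝ → ℝ} {T t x : ℝ} {f ρ g σ : ℝ → ℝ → ℝ}

theorem hasDerivWithinAt_f (h : IsDirichletSolution f₀ ρ₀ T f ρ) (ht : t ∈ Ico 0 T)
    (hx : x ∈ Icc (0 : ℝ) 1) : HasDerivWithinAt (f t) (dX (f t) x) (Icc 0 1) x :=
  (h.diff_f t ht x hx).hasDerivWithinAt

theorem hasDerivWithinAt_fx (h : IsDirichletSolution f₀ ρ₀ T f ρ) (ht : t ∈ Ico 0 T)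
    (hx : x ∈ Icc (0 : ℝ) 1) : HasDerivWithinAt (dX (f t)) (dX (dX (f t)) x) (Icc 0 1) x :=
  (h.diff_fx t ht x hx).hasDerivWithinAt

theorem hasDerivWithinAt_rho (h : IsDirichletSolution f₀ ρ₀ T f ρ) (ht : t ∈ Ico 0 T)
    (hx : x ∈ Icc (0 : ℝ) 1) : HasDerivWithinAt (ρ t) (dX (ρ t) x) (Icc 0 1) x :=
  (h.diff_rho t ht x hx).hasDerivWithinAt

theorem hasDerivAt_fx (h : IsDirichletSolution f₀ ρ₀ T f ρ) (ht : t ∈ Ioo 0 T)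
    (hx : x ∈ Icc (0 : ℝ) 1) :
    HasDerivAt (fun s => dX (f s) x)
      (nonlocalI (f t) (ρ t) - f t x * dX (dX (f t)) x + (dX (f t) x) ^ 2 - ρ t x) t :=
  (h.diff_t_fx t ht x hx).hasDerivAt.congr_deriv (by linarith [h.eq_f t ht x hx])

theorem hasDerivAt_rho (h : IsDirichletSolution f₀ ρ₀ T f ρ) (ht : t ∈ Ioo 0 T)
    (hx : x ∈ Icc (0 : ℝ) 1) :
    HasDerivAt (fun s => ρ s x) (ρ t x * dX (f t) x - f t x * dX (ρ t) x) t :=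
  (h.diff_t_rho t ht x hx).hasDerivAt.congr_deriv (by linarith [h.eq_rho t ht x hx])

theorem continuousOn_fx_slice (h : IsDirichletSolution f₀ ρ₀ T f ρ) (ht : t ∈ Ico 0 T) :
    ContinuousOn (dX (f t)) (Icc 0 1) :=
  ContinuousOn.uncurry_left (f := fun t => dX (f t)) t ht h.cont_fx

theorem continuousOn_fxx_slice (h : IsDirichletSolution f₀ ρ₀ T f ρ) (ht : t ∈ Ico 0 T) :
    ContinuousOn (dX (dX (f t))) (Icc 0 1) :=
  ContinuousOn.uncurry_left (f := fun t => dX (dX (f t))) t ht h.cont_fxx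

theorem continuousOn_rhox_slice (h : IsDirichletSolution f₀ ρ₀ T f ρ) (ht : t ∈ Ico 0 T) :
    ContinuousOn (dX (ρ t)) (Icc 0 1) :=
  ContinuousOn.uncurry_left (f := fun t => dX (ρ t)) t ht h.cont_rhox

theorem continuousOn_nonlocalI (h : IsDirichletSolution f₀ ρ₀ T f ρ) :
    ContinuousOn (fun t => nonlocalI (f t) (ρ t)) (Ico 0 T) :=
  (continuousOn_parametric_integral_of_mem h.cont_rho unitInterval.one_mem).sub
    ((continuousOn_parametric_integral_of_mem (h := fun t x => (dX (f t) x) ^ 2) (h.cont_fx.pow 2)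
      unitInterval.one_mem).const_mul 2)

theorem exists_bound (h : IsDirichletSolution f₀ ρ₀ T f ρ) {t₁ : ℝ} (ht₁ : t₁ < T) :
    ∃ K, ∀ t ∈ Icc 0 t₁, ∀ x ∈ Icc (0 : ℝ) 1,
      |dX (f t) x| ≤ K ∧ |dX (dX (f t)) x| ≤ K ∧ |ρ t x| ≤ K ∧ |dX (ρ t) x| ≤ K := by
  have hsub : Icc 0 t₁ ×ˢ Icc (0 : ℝ) 1 ⊆ Ico 0 T ×ˢ Icc 0 1 :=
    prod_mono_left (Icc_subset_Ico_right ht₁)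
  obtain ⟨K, hK⟩ := (isCompact_Icc.prod isCompact_Icc).exists_bound_of_continuousOn
    ((h.cont_fx.prodMk (h.cont_fxx.prodMk (h.cont_rho.prodMk h.cont_rhox))).mono hsub)
  refine ⟨K, fun t ht x hx => ?_⟩
  simpa only [norm_prod_le_iff, Real.norm_eq_abs] using hK (t, x) ⟨ht, hx⟩

theorem continuousOn_energyDensity (h : IsDirichletSolution f₀ ρ₀ T f ρ)
    (k : IsDirichletSolution f₀ ρ₀ T g σ) :
    ContinuousOn (Function.uncurry (energyDensity f ρ g σ)) (Ico 0 T ×ˢ Icc 0 1) :=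
  ((h.cont_fx.sub k.cont_fx).pow 2).add ((h.cont_rho.sub k.cont_rho).pow 2)

theorem continuousOn_energyProduction (h : IsDirichletSolution f₀ ρ₀ T f ρ)
    (k : IsDirichletSolution f₀ ρ₀ T g σ) :
    ContinuousOn (Function.uncurry (energyProduction f ρ g σ)) (Ico 0 T ×ˢ Icc 0 1) := by
  have hJ : ContinuousOn (fun p : ℝ × ℝ => nonlocalI (f p.1) (ρ p.1) - nonlocalI (g p.1) (σ p.1))
      (Ico 0 T ×ˢ Icc 0 1) :=
    (h.continuousOn_nonlocalI.sub k.continuousOn_nonlocalI).comp (f := Prod.fst)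
      continuousOn_fst fun p hp => hp.1
  obtain ⟨-, -, -, hf, hfx, hfxx, hρ, hρx, -⟩ := h
  obtain ⟨-, -, -, hg, hgx, hgxx, hσ, hσx, -⟩ := k
  unfold Function.uncurry energyProduction
  fun_prop

theorem hasDerivAt_energy (h : IsDirichletSolution f₀ ρ₀ T f ρ)
    (k : IsDirichletSolution f₀ ρ₀ T g σ) (ht : t ∈ Ioo 0 T) :
    HasDerivAt (fun s => ∫ x in (0 : ℝ)..1, energyDensity f ρ g σ s x)
      (∫ x in (0 : ℝ)..1, energyProduction f ρ g σ t x) t := by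
  have hsub : Ioo 0 T ×ˢ Icc (0 : ℝ) 1 ⊆ Ico 0 T ×ˢ Icc 0 1 := prod_mono_left Ioo_subset_Ico_self
  refine hasDerivAt_parametric_integral isOpen_Ioo ((h.continuousOn_energyDensity k).mono hsub)
    ((h.continuousOn_energyProduction k).mono hsub) (fun s hs x hx => ?_) ht
    unitInterval.one_mem
  refine ((((h.hasDerivAt_fx hs hx).sub (k.hasDerivAt_fx hs hx)).pow 2).add
    (((h.hasDerivAt_rho hs hx).sub (k.hasDerivAt_rho hs hx)).pow 2)).congr_deriv ?_
  simp only [energyProduction, Pi.sub_apply, Nat.cast_ofNat, Nat.add_one_sub_one, pow_one]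
  ring

theorem sq_sub_le_energy (h : IsDirichletSolution f₀ ρ₀ T f ρ)
    (k : IsDirichletSolution f₀ ρ₀ T g σ) (ht : t ∈ Ico 0 T) (hx : x ∈ Icc (0 : ℝ) 1) :
    (f t x - g t x) ^ 2 ≤ ∫ y in (0 : ℝ)..1, energyDensity f ρ g σ t y := by
  have cu := (h.continuousOn_fx_slice ht).sub (k.continuousOn_fx_slice ht)
  have hpoincare := sq_sub_le_mul_integral_sq_deriv (w := fun y => f t y - g t y)
    (fun y hy => (h.hasDerivWithinAt_f ht hy).sub (k.hasDerivWithinAt_f ht hy)) cu hx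
  simp only [(h.bdry_f t ht).1, (k.bdry_f t ht).1, sub_zero, one_mul] at hpoincare
  refine hpoincare.trans (intervalIntegral.integral_mono_on zero_le_one
    ((cu.pow 2).intervalIntegrable_of_Icc zero_le_one)
    (((h.continuousOn_energyDensity k).uncurry_left t ht).intervalIntegrable_of_Icc zero_le_one)
    fun y _ => le_add_of_nonneg_right (sq_nonneg _))

theorem integral_fx_sub_eq_zero (h : IsDirichletSolution f₀ ρ₀ T f ρ)
    (k : IsDirichletSolution f₀ ρ₀ T g σ) (ht : t ∈ Ico 0 T) :
    ∫ x in (0 : ℝ)..1, (dX (f t) x - dX (g t) x) = 0 := by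
  rw [integral_eq_sub_of_hasDerivWithinAt_Icc (u := fun x => f t x - g t x)
    (fun x hx => (h.hasDerivWithinAt_f ht hx).sub (k.hasDerivWithinAt_f ht hx))
    ((h.continuousOn_fx_slice ht).sub (k.continuousOn_fx_slice ht)) unitInterval.one_mem]
  simp [h.bdry_f t ht, k.bdry_f t ht]

theorem continuousOn_energyDensityX (h : IsDirichletSolution f₀ ρ₀ T f ρ)
    (k : IsDirichletSolution f₀ ρ₀ T g σ) (ht : t ∈ Ico 0 T) :
    ContinuousOn (energyDensityX f ρ g σ t) (Icc 0 1) := by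
  have hfx := h.continuousOn_fx_slice ht
  have hfxx := h.continuousOn_fxx_slice ht
  have hρ := h.cont_rho.uncurry_left t ht
  have hρx := h.continuousOn_rhox_slice ht
  have hgx := k.continuousOn_fx_slice ht
  have hgxx := k.continuousOn_fxx_slice ht
  have hσ := k.cont_rho.uncurry_left t ht
  have hσx := k.continuousOn_rhox_slice ht
  unfold energyDensityX
  fun_prop

theorem hasDerivWithinAt_energyDensity (h : IsDirichletSolution f₀ ρ₀ T f ρ)
    (k : IsDirichletSolution f₀ ρ₀ T g σ) (ht : t ∈ Ico 0 T) (hx : x ∈ Icc (0 : ℝ) 1) :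
    HasDerivWithinAt (energyDensity f ρ g σ t) (energyDensityX f ρ g σ t x) (Icc 0 1) x := by
  refine ((((h.hasDerivWithinAt_fx ht hx).sub (k.hasDerivWithinAt_fx ht hx)).pow 2).add
    (((h.hasDerivWithinAt_rho ht hx).sub (k.hasDerivWithinAt_rho ht hx)).pow 2)).congr_deriv ?_
  simp [energyDensityX]

theorem integral_energyFlux_eq_zero (h : IsDirichletSolution f₀ ρ₀ T f ρ)
    (k : IsDirichletSolution f₀ ρ₀ T g σ) (ht : t ∈ Ico 0 T) :
    ∫ x in (0 : ℝ)..1, (dX (f t) x * energyDensity f ρ g σ t x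
      + f t x * energyDensityX f ρ g σ t x) = 0 :=
  integral_deriv_mul_eq_zero zero_le_one (fun _ hx => h.hasDerivWithinAt_f ht hx)
    (fun _ hx => h.hasDerivWithinAt_energyDensity k ht hx) (h.continuousOn_fx_slice ht)
    (h.continuousOn_energyDensityX k ht) (h.bdry_f t ht).1 (h.bdry_f t ht).2

theorem integral_energyProduction_le (h : IsDirichletSolution f₀ ρ₀ T f ρ)
    (k : IsDirichletSolution f₀ ρ₀ T g σ) (ht : t ∈ Ico 0 T) {K : ℝ}
    (hK : ∀ x ∈ Icc (0 : ℝ) 1, |dX (f t) x| ≤ K)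
    (kK : ∀ x ∈ Icc (0 : ℝ) 1,
      |dX (g t) x| ≤ K ∧ |dX (dX (g t)) x| ≤ K ∧ |σ t x| ≤ K ∧ |dX (σ t) x| ≤ K) :
    ∫ x in (0 : ℝ)..1, energyProduction f ρ g σ t x
      ≤ (12 * K + 1) * ∫ x in (0 : ℝ)..1, energyDensity f ρ g σ t x := by
  set E := ∫ x in (0 : ℝ)..1, energyDensity f ρ g σ t x
  set J := nonlocalI (f t) (ρ t) - nonlocalI (g t) (σ t)
  have ii : ∀ {v : ℝ → ℝ}, ContinuousOn v (Icc 0 1) → IntervalIntegrable v volume 0 1 :=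
    fun hv => hv.intervalIntegrable_of_Icc zero_le_one
  have ce := (h.continuousOn_energyDensity k).uncurry_left t ht
  have cu : ContinuousOn (fun x => 2 * J * (dX (f t) x - dX (g t) x)) (Icc 0 1) :=
    ((h.continuousOn_fx_slice ht).sub (k.continuousOn_fx_slice ht)).const_mul _
  have cflux : ContinuousOn (fun x => dX (f t) x * energyDensity f ρ g σ t x
      + f t x * energyDensityX f ρ g σ t x) (Icc 0 1) :=
    ((h.continuousOn_fx_slice ht).mul ce).add
      ((h.cont_f.uncurry_left t ht).mul (h.continuousOn_energyDensityX k ht))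
  have cmain : ContinuousOn (fun x => 2 * J * (dX (f t) x - dX (g t) x)
      - (dX (f t) x * energyDensity f ρ g σ t x + f t x * energyDensityX f ρ g σ t x))
      (Icc 0 1) := cu.sub cflux
  have clin : ContinuousOn (fun x => (10 * K + 1) * energyDensity f ρ g σ t x) (Icc 0 1) :=
    ce.const_mul _
  have crest : ContinuousOn (fun x => (10 * K + 1) * energyDensity f ρ g σ t x + 2 * K * E)
      (Icc 0 1) := clin.add continuousOn_const
  calc ∫ x in (0 : ℝ)..1, energyProduction f ρ g σ t x
      ≤ ∫ x in (0 : ℝ)..1, (2 * J * (dX (f t) x - dX (g t) x)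
          - (dX (f t) x * energyDensity f ρ g σ t x + f t x * energyDensityX f ρ g σ t x)
          + ((10 * K + 1) * energyDensity f ρ g σ t x + 2 * K * E)) := by
        refine intervalIntegral.integral_mono_on zero_le_one
          (ii ((h.continuousOn_energyProduction k).uncurry_left t ht))
          (ii (cmain.add crest)) fun x hx => ?_
        obtain ⟨hgx, hgxx, hσ, hσx⟩ := kK x hx
        exact energy_production_pointwise_le (hK x hx) hgxx hσ hσx
          ((abs_add_le _ _).trans (by linarith [hK x hx])) (h.sq_sub_le_energy k ht hx)
    _ = (12 * K + 1) * E := by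
        rw [intervalIntegral.integral_add (ii cmain) (ii crest),
          intervalIntegral.integral_sub (ii cu) (ii cflux), h.integral_energyFlux_eq_zero k ht,
          intervalIntegral.integral_const_mul, h.integral_fx_sub_eq_zero k ht,
          intervalIntegral.integral_add (ii clin) intervalIntegrable_const,
          intervalIntegral.integral_const_mul, intervalIntegral.integral_const]
        simp only [smul_eq_mul, E]
        ring

theorem energy_eq_zero (h : IsDirichletSolution f₀ ρ₀ T f ρ)
    (k : IsDirichletSolution f₀ ρ₀ T g σ) (ht : t ∈ Ico 0 T) :
    ∫ x in (0 : ℝ)..1, energyDensity f ρ g σ t x = 0 := by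
  have hsub : Icc 0 t ⊆ Ico 0 T := Icc_subset_Ico_right ht.2
  obtain ⟨K₁, hK₁⟩ := h.exists_bound ht.2
  obtain ⟨K₂, hK₂⟩ := k.exists_bound ht.2
  have hinit : ∫ x in (0 : ℝ)..1, energyDensity f ρ g σ 0 x = 0 := by
    have hf : EqOn (f 0) (g 0) (Icc 0 1) := fun x hx => (h.init_f x hx).trans (k.init_f x hx).symm
    refine (intervalIntegral.integral_congr (g := fun _ => 0) fun x hx => ?_).trans (by simp)
    rw [uIcc_of_le zero_le_one] at hx
    simp [energyDensity, dX_congr hf hx, h.init_rho x hx, k.init_rho x hx]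
  have hcont : ContinuousOn (fun s => ∫ x in (0 : ℝ)..1, energyDensity f ρ g σ s x) (Ico 0 T) :=
    continuousOn_parametric_integral_of_mem (h.continuousOn_energyDensity k) unitInterval.one_mem
  have hgronwall := le_mul_exp_of_deriv_le_mul (C := 12 * max K₁ K₂ + 1) (hcont.mono hsub)
    (fun s hs => h.hasDerivAt_energy k ⟨hs.1, hs.2.trans ht.2⟩) (fun s hs => ?_)
    (right_mem_Icc.2 ht.1)
  · rw [hinit, zero_mul] at hgronwall
    exact hgronwall.antisymm
      (intervalIntegral.integral_nonneg zero_le_one fun x _ => energyDensity_nonneg f ρ g σ t x)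
  · have hs := Ioo_subset_Icc_self hs
    refine h.integral_energyProduction_le k (hsub hs)
      (fun x hx => (hK₁ s hs x hx).1.trans (le_max_left _ _)) fun x hx => ?_
    obtain ⟨hgx, hgxx, hσ, hσx⟩ := hK₂ s hs x hx
    exact ⟨hgx.trans (le_max_right _ _), hgxx.trans (le_max_right _ _),
      hσ.trans (le_max_right _ _), hσx.trans (le_max_right _ _)⟩

theorem unique (h : IsDirichletSolution f₀ ρ₀ T f ρ) (k : IsDirichletSolution f₀ ρ₀ T g σ)
    (ht : t ∈ Ico 0 T) (hx : x ∈ Icc (0 : ℝ) 1) : f t x = g t x ∧ ρ t x = σ t x := by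
  have hE := h.energy_eq_zero k ht
  have hdensity : energyDensity f ρ g σ t x = 0 := by
    by_contra hne
    exact (intervalIntegral.integral_pos zero_lt_one
      ((h.continuousOn_energyDensity k).uncurry_left t ht)
      (fun y _ => energyDensity_nonneg f ρ g σ t y)
      ⟨x, hx, (energyDensity_nonneg f ρ g σ t x).lt_of_ne' hne⟩).ne' hE
  have hf := hE ▸ h.sq_sub_le_energy k ht hx
  exact ⟨sub_eq_zero.1 (pow_eq_zero_iff two_ne_zero |>.1 (hf.antisymm (sq_nonneg _))),
    sub_eq_zero.1 (pow_eq_zero_iff two_ne_zero |>.1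
      ((add_eq_zero_iff_of_nonneg (sq_nonneg _) (sq_nonneg _)).1 hdensity).2)⟩

theorem mono (h : IsDirichletSolution f₀ ρ₀ T f ρ) {T' : ℝ} (hT : T' ≤ T) :
    IsDirichletSolution f₀ ρ₀ T' f ρ := by
  have hIco : Ico 0 T' ⊆ Ico 0 T := Ico_subset_Ico_right hT
  have hIoo : Ioo 0 T' ⊆ Ioo 0 T := Ioo_subset_Ioo_right hT
  have hprod : Ico 0 T' ×ˢ Icc (0 : ℝ) 1 ⊆ Ico 0 T ×ˢ Icc 0 1 := prod_mono_left hIco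
  exact ⟨fun t ht => h.diff_f t (hIco ht), fun t ht => h.diff_fx t (hIco ht),
    fun t ht => h.diff_rho t (hIco ht), h.cont_f.mono hprod, h.cont_fx.mono hprod,
    h.cont_fxx.mono hprod, h.cont_rho.mono hprod, h.cont_rhox.mono hprod,
    fun t ht => h.diff_t_fx t (hIoo ht), fun t ht => h.diff_t_rho t (hIoo ht),
    fun t ht => h.eq_f t (hIoo ht), fun t ht => h.eq_rho t (hIoo ht), h.init_f, h.init_rho,
    fun t ht => h.bdry_f t (hIco ht), fun t ht => h.bdry_rho t (hIco ht)⟩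

theorem le_of_tendsto_integral_fx_atTop (h : IsDirichletSolution f₀ ρ₀ T f ρ) (hT : 0 < T)
    (hx : x ∈ Icc (0 : ℝ) 1)
    (hblow : Tendsto (fun t : ℝ => ∫ s in (0 : ℝ)..t, dX (f s) x) (𝓝[<] T) atTop)
    {T' : ℝ} (k : IsDirichletSolution f₀ ρ₀ T' g σ) : T' ≤ T := by
  by_contra! hlt
  obtain ⟨K, hK⟩ := k.exists_bound hlt
  have hK₀ : 0 ≤ K := (abs_nonneg _).trans (hK 0 (left_mem_Icc.2 hT.le) x hx).1
  have hbound : ∀ᶠ t in 𝓝[<] T, ∫ s in (0 : ℝ)..t, dX (f s) x ≤ K * T := by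
    filter_upwards [Ioo_mem_nhdsLT hT] with t ht
    have hnorm := intervalIntegral.norm_integral_le_of_norm_le_const (a := (0 : ℝ)) (b := t)
      (f := fun s => dX (f s) x) (C := K) fun s hs => by
        rw [uIoc_of_le ht.1.le] at hs
        have hsT : s ∈ Ico 0 T := ⟨hs.1.le, hs.2.trans_lt ht.2⟩
        rw [dX_congr (fun y hy => (h.unique (k.mono hlt.le) hsT hy).1) hx]
        exact (hK s (Ico_subset_Icc_self hsT) x hx).1
    rw [sub_zero, abs_of_pos ht.1] at hnorm
    exact (le_abs_self _).trans (hnorm.trans (mul_le_mul_of_nonneg_left ht.2.le hK₀))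
  obtain ⟨t, hle, hgt⟩ := (hbound.and (hblow.eventually_gt_atTop (K * T))).exists
  exact hle.not_gt hgt

end IsDirichletSolution

section ReciprocalIntegrals

variable {U : Set ℝ} {a b c t : ℝ} {u u₁ u₂ : ℝ → ℝ → ℝ}

theorem hasDerivAt_integral_inv (hU : IsOpen U)
    (hu : ContinuousOn (fun p : ℝ × ℝ => u p.1 p.2) (U ×ˢ Icc a b))
    (hu₁ : ContinuousOn (fun p : ℝ × ℝ => u₁ p.1 p.2) (U ×ˢ Icc a b))
    (hne : ∀ t ∈ U, ∀ x ∈ Icc a b, u t x ≠ 0)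
    (hd : ∀ t ∈ U, ∀ x ∈ Icc a b, HasDerivAt (fun s => u s x) (u₁ t x) t)
    (ht : t ∈ U) (hc : c ∈ Icc a b) :
    HasDerivAt (fun s => ∫ x in a..c, (u s x)⁻¹) (∫ x in a..c, -u₁ t x / u t x ^ 2) t :=
  hasDerivAt_parametric_integral hU (hu.inv₀ fun p hp => hne p.1 hp.1 p.2 hp.2)
    (hu₁.neg.div (hu.pow 2) fun p hp => pow_ne_zero 2 (hne p.1 hp.1 p.2 hp.2))
    (fun t ht x hx => (hd t ht x hx).fun_inv (hne t ht x hx)) ht hc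

theorem hasDerivAt_integral_neg_div_sq (hU : IsOpen U)
    (hu : ContinuousOn (fun p : ℝ × ℝ => u p.1 p.2) (U ×ˢ Icc a b))
    (hu₁ : ContinuousOn (fun p : ℝ × ℝ => u₁ p.1 p.2) (U ×ˢ Icc a b))
    (hu₂ : ContinuousOn (fun p : ℝ × ℝ => u₂ p.1 p.2) (U ×ˢ Icc a b))
    (hne : ∀ t ∈ U, ∀ x ∈ Icc a b, u t x ≠ 0)
    (hd : ∀ t ∈ U, ∀ x ∈ Icc a b, HasDerivAt (fun s => u s x) (u₁ t x) t)
    (hd₁ : ∀ t ∈ U, ∀ x ∈ Icc a b, HasDerivAt (fun s => u₁ s x) (u₂ t x) t)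
    (ht : t ∈ U) (hc : c ∈ Icc a b) :
    HasDerivAt (fun s => ∫ x in a..c, -u₁ s x / u s x ^ 2)
      (∫ x in a..c, (2 * u₁ t x ^ 2 / u t x ^ 3 - u₂ t x / u t x ^ 2)) t := by
  have hpow : ∀ n, ∀ p ∈ U ×ˢ Icc a b, u p.1 p.2 ^ n ≠ 0 := fun n p hp =>
    pow_ne_zero n (hne p.1 hp.1 p.2 hp.2)
  refine hasDerivAt_parametric_integral
    (h' := fun t x => 2 * u₁ t x ^ 2 / u t x ^ 3 - u₂ t x / u t x ^ 2) hU
    (hu₁.neg.div (hu.pow 2) (hpow 2))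
    (((hu₁.pow 2).const_mul 2 |>.div (hu.pow 3) (hpow 3)).sub (hu₂.div (hu.pow 2) (hpow 2)))
    (fun t ht x hx => ?_) ht hc
  have hx0 := hne t ht x hx
  refine ((hd₁ t ht x hx).fun_neg.fun_div ((hd t ht x hx).fun_pow 2)
    (pow_ne_zero 2 hx0)).congr_deriv ?_
  field_simp
  ring

end ReciprocalIntegrals

section MovingPoint

variable {a b t : ℝ} {U : Set ℝ} {k kx : ℝ → ℝ → ℝ} {X : ℝ → ℝ}

theorem hasDerivAt_of_sub_eq_mul {f g h : ℝ → ℝ} {g₀ h' : ℝ} (hg : Tendsto g (𝓝 t) (𝓝 g₀))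
    (hh : HasDerivAt h h' t) (heq : ∀ᶠ s in 𝓝 t, f s - f t = g s * (h s - h t)) :
    HasDerivAt f (g₀ * h') t := by
  rw [hasDerivAt_iff_tendsto_slope] at hh ⊢
  refine ((hg.mono_left nhdsWithin_le_nhds).mul hh).congr' ?_
  filter_upwards [heq.filter_mono nhdsWithin_le_nhds] with s hs
  simp only [slope_def_field, hs, mul_div_assoc]

theorem tendsto_of_mem_uIcc {c : ℝ → ℝ} (hX : ContinuousAt X t)
    (hc : ∀ᶠ s in 𝓝 t, c s ∈ uIcc (X t) (X s)) : Tendsto c (𝓝 t) (𝓝 (X t)) := by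
  have hmin := (tendsto_const_nhds (x := X t)).inf_nhds hX.tendsto
  have hmax := (tendsto_const_nhds (x := X t)).sup_nhds hX.tendsto
  rw [inf_idem] at hmin
  rw [sup_idem] at hmax
  exact tendsto_of_tendsto_of_tendsto_of_le_of_le' hmin hmax (hc.mono fun _ h => h.1)
    (hc.mono fun _ h => h.2)

theorem exists_mem_uIcc_sub_eq_mul {u u' : ℝ → ℝ}
    (hu : ∀ x ∈ Icc a b, HasDerivWithinAt u (u' x) (Icc a b) x) {x y : ℝ} (hx : x ∈ Icc a b)
    (hy : y ∈ Icc a b) : ∃ c ∈ uIcc x y, u y - u x = u' c * (y - x) := by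
  wlog hxy : x ≤ y generalizing x y
  · obtain ⟨c, hc, h⟩ := this hy hx (not_le.1 hxy).le
    exact ⟨c, uIcc_comm x y ▸ hc, by linarith⟩
  rcases hxy.eq_or_lt with rfl | hlt
  · exact ⟨x, left_mem_uIcc, by simp⟩
  have hsub : Icc x y ⊆ Icc a b := Icc_subset_Icc hx.1 hy.2
  obtain ⟨c, hc, h⟩ := exists_hasDerivAt_eq_slope u u' hlt
    (fun z hz => (hu z (hsub hz)).continuousWithinAt.mono hsub) fun z hz =>
      (hu z (hsub (Ioo_subset_Icc_self hz))).hasDerivAt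
        (Icc_mem_nhds (hx.1.trans_lt hz.1) (hz.2.trans_le hy.2))
  refine ⟨c, Icc_subset_uIcc (Ioo_subset_Icc_self hc), ?_⟩
  rw [h, div_mul_cancel₀ _ (sub_pos.2 hlt).ne']

theorem exists_tendsto_sub_eq_mul (hU : U ∈ 𝓝 t)
    (hk : ∀ s ∈ U, ∀ x ∈ Icc a b, HasDerivWithinAt (k s) (kx s x) (Icc a b) x)
    (hkx : ContinuousOn (fun p : ℝ × ℝ => kx p.1 p.2) (U ×ˢ Icc a b))
    (hXmem : ∀ s ∈ U, X s ∈ Icc a b) (hX : ContinuousAt X t) :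
    ∃ g : ℝ → ℝ, Tendsto g (𝓝 t) (𝓝 (kx t (X t))) ∧
      ∀ᶠ s in 𝓝 t, k s (X s) - k s (X t) = g s * (X s - X t) := by
  have htU : t ∈ U := mem_of_mem_nhds hU
  have hmvt : ∀ s, ∃ c, s ∈ U → c ∈ uIcc (X t) (X s) ∧
      k s (X s) - k s (X t) = kx s c * (X s - X t) := fun s => by
    by_cases hs : s ∈ U
    · obtain ⟨c, hc, h⟩ := exists_mem_uIcc_sub_eq_mul (hk s hs) (hXmem t htU) (hXmem s hs)
      exact ⟨c, fun _ => ⟨hc, h⟩⟩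
    · exact ⟨0, fun h => absurd h hs⟩
  choose c hc using hmvt
  have hcU : ∀ s ∈ U, c s ∈ Icc a b := fun s hs =>
    (ordConnected_Icc.uIcc_subset (hXmem t htU) (hXmem s hs)) (hc s hs).1
  have hclim : Tendsto c (𝓝 t) (𝓝 (X t)) :=
    tendsto_of_mem_uIcc hX (eventually_of_mem hU fun s hs => (hc s hs).1)
  refine ⟨fun s => kx s (c s), ?_, eventually_of_mem hU fun s hs => (hc s hs).2⟩
  exact (hkx (t, X t) ⟨htU, hXmem t htU⟩).tendsto.comp (tendsto_nhdsWithin_iff.2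
    ⟨tendsto_id.prodMk_nhds hclim, eventually_of_mem hU fun s hs => ⟨hs, hcU s hs⟩⟩)

theorem hasDerivAt_comp_moving_point {k₁ X' : ℝ} (hU : U ∈ 𝓝 t)
    (hk : ∀ s ∈ U, ∀ x ∈ Icc a b, HasDerivWithinAt (k s) (kx s x) (Icc a b) x)
    (hkx : ContinuousOn (fun p : ℝ × ℝ => kx p.1 p.2) (U ×ˢ Icc a b))
    (hXmem : ∀ s ∈ U, X s ∈ Icc a b) (hkt : HasDerivAt (fun s => k s (X t)) k₁ t)
    (hX : HasDerivAt X X' t) :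
    HasDerivAt (fun s => k s (X s)) (k₁ + kx t (X t) * X') t := by
  obtain ⟨g, hg, heq⟩ := exists_tendsto_sub_eq_mul hU hk hkx hXmem hX.continuousAt
  have hdiff : HasDerivAt (fun s => k s (X s) - k s (X t)) (kx t (X t) * X') t :=
    hasDerivAt_of_sub_eq_mul hg hX (by simpa using heq)
  exact (hkt.add hdiff).congr_of_eventuallyEq (Eventually.of_forall fun s => by simp)

theorem hasDerivAt_of_implicit {y k₁ : ℝ} (hU : U ∈ 𝓝 t)
    (hk : ∀ s ∈ U, ∀ x ∈ Icc a b, HasDerivWithinAt (k s) (kx s x) (Icc a b) x)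
    (hkx : ContinuousOn (fun p : ℝ × ℝ => kx p.1 p.2) (U ×ˢ Icc a b))
    (hXmem : ∀ s ∈ U, X s ∈ Icc a b) (hX : ContinuousAt X t) (hlevel : ∀ s ∈ U, k s (X s) = y)
    (hkt : HasDerivAt (fun s => k s (X t)) k₁ t) (hne : kx t (X t) ≠ 0) :
    HasDerivAt X (-k₁ / kx t (X t)) t := by
  obtain ⟨g, hg, heq⟩ := exists_tendsto_sub_eq_mul hU hk hkx hXmem hX
  rw [neg_div, div_eq_inv_mul, ← neg_mul]
  refine hasDerivAt_of_sub_eq_mul (hg.inv₀ hne).neg hkt ?_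
  filter_upwards [heq, hU, hg.eventually_ne hne] with s hs hsU hgs
  have hlev : k s (X t) - k t (X t) = -(g s * (X s - X t)) := by
    rw [hlevel t (mem_of_mem_nhds hU), ← hlevel s hsU, ← hs, neg_sub]
  rw [hlev]
  field_simp

end MovingPoint

section InverseFamily

theorem continuousOn_inverse_of_strictMonoOn {α β γ : Type*} [TopologicalSpace α]
    [LinearOrder β] [TopologicalSpace β] [OrderTopology β]
    [LinearOrder γ] [TopologicalSpace γ] [OrderClosedTopology γ]
    {S : Set α} {J : Set β} [OrdConnected J] {Y : Set γ} {g : α → β → γ} {X : α → γ → β}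
    (hg : ∀ x ∈ J, ContinuousOn (fun t => g t x) S) (hmono : ∀ t ∈ S, StrictMonoOn (g t) J)
    (hX : ∀ t ∈ S, ∀ y ∈ Y, X t y ∈ J) (hgX : ∀ t ∈ S, ∀ y ∈ Y, g t (X t y) = y) :
    ContinuousOn (fun p : α × γ => X p.1 p.2) (S ×ˢ Y) := by
  rintro ⟨t, y⟩ ⟨ht, hy⟩
  have hgc : ∀ c ∈ J, Tendsto (fun p : α × γ => g p.1 c) (𝓝[S ×ˢ Y] (t, y)) (𝓝 (g t c)) :=
    fun c hc => (hg c hc t ht).tendsto.comp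
      (continuousWithinAt_fst.tendsto_nhdsWithin fun p hp => hp.1)
  have hsnd : Tendsto Prod.snd (𝓝[S ×ˢ Y] (t, y)) (𝓝 y) := continuousWithinAt_snd
  refine tendsto_order.2 ⟨fun c hc => ?_, fun c hc => ?_⟩
  · by_cases hcJ : c ∈ J
    · have hlt : g t c < y := (hmono t ht hcJ (hX t ht y hy) hc).trans_eq (hgX t ht y hy)
      filter_upwards [self_mem_nhdsWithin, (hgc c hcJ).eventually_lt hsnd hlt] with p hp hpc
      exact ((hmono p.1 hp.1).lt_iff_lt hcJ (hX p.1 hp.1 p.2 hp.2)).1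
        (hpc.trans_eq (hgX p.1 hp.1 p.2 hp.2).symm)
    · filter_upwards [self_mem_nhdsWithin] with p hp
      exact lt_of_not_ge fun h =>
        hcJ (OrdConnected.out ‹_› (hX p.1 hp.1 p.2 hp.2) (hX t ht y hy) ⟨h, hc.le⟩)
  · by_cases hcJ : c ∈ J
    · have hlt : y < g t c := (hgX t ht y hy).symm.trans_lt (hmono t ht (hX t ht y hy) hcJ hc)
      filter_upwards [self_mem_nhdsWithin, hsnd.eventually_lt (hgc c hcJ) hlt] with p hp hpc
      exact ((hmono p.1 hp.1).lt_iff_lt (hX p.1 hp.1 p.2 hp.2) hcJ).1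
        ((hgX p.1 hp.1 p.2 hp.2).trans_lt hpc)
    · filter_upwards [self_mem_nhdsWithin] with p hp
      exact lt_of_not_ge fun h =>
        hcJ (OrdConnected.out ‹_› (hX t ht y hy) (hX p.1 hp.1 p.2 hp.2) ⟨hc.le, h⟩)

theorem hasDerivWithinAt_of_leftInverse {g X : ℝ → ℝ} {s Y : Set ℝ} {g' y : ℝ}
    (hXmem : MapsTo X Y s) (hX : ContinuousWithinAt X Y y) (hy : y ∈ Y)
    (hg : HasDerivWithinAt g g' s (X y)) (hne : g' ≠ 0) (hgX : ∀ z ∈ Y, g (X z) = z) :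
    HasDerivWithinAt X g'⁻¹ Y y := by
  have hequiv : HasFDerivWithinAt g
      (ContinuousLinearEquiv.unitsEquivAut ℝ (Units.mk0 g' hne) : ℝ →L[ℝ] ℝ) s (X y) := hg
  exact hequiv.of_local_left_inverse (hX.tendsto_nhdsWithin hXmem) hy
    (eventually_of_mem self_mem_nhdsWithin hgX)

end InverseFamily

/-- Lagrangian description of a solution with initial strain `F = f₀'` and initial density `R`:
`W t x` is the reciprocal `1 / γ_x(t,x)` of the Jacobian of the flow `γ` of `f`, with time
derivative `Wt` and label derivatives `Wx`, `Wtx`. In these variables the problem becomes the linear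
equation `W_tt + I(t) W = R`, coupled through the constraint `γ(t,1) = ∫₀¹ dx / W = 1` that
determines `I`. -/
structure ReciprocalJacobian (F R : ℝ → ℝ) (T : ℝ) where
  W : ℝ → ℝ → ℝ
  Wt : ℝ → ℝ → ℝ
  Wx : ℝ → ℝ → ℝ
  Wtx : ℝ → ℝ → ℝ
  I : ℝ → ℝ
  cont_W : ContinuousOn (fun p : ℝ × ℝ => W p.1 p.2) (Ico 0 T ×ˢ Icc 0 1)
  cont_Wt : ContinuousOn (fun p : ℝ × ℝ => Wt p.1 p.2) (Ico 0 T ×ˢ Icc 0 1)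
  cont_Wx : ContinuousOn (fun p : ℝ × ℝ => Wx p.1 p.2) (Ico 0 T ×ˢ Icc 0 1)
  cont_Wtx : ContinuousOn (fun p : ℝ × ℝ => Wtx p.1 p.2) (Ico 0 T ×ˢ Icc 0 1)
  cont_I : ContinuousOn I (Ioo 0 T)
  cont_R : ContinuousOn R (Icc 0 1)
  hasDerivAt_W : ∀ t ∈ Ioo 0 T, ∀ x ∈ Icc (0 : ℝ) 1, HasDerivAt (fun s => W s x) (Wt t x) t
  hasDerivAt_Wt : ∀ t ∈ Ioo 0 T, ∀ x ∈ Icc (0 : ℝ) 1,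
    HasDerivAt (fun s => Wt s x) (R x - I t * W t x) t
  hasDerivWithinAt_W : ∀ t ∈ Ico 0 T, ∀ x ∈ Icc (0 : ℝ) 1,
    HasDerivWithinAt (W t) (Wx t x) (Icc 0 1) x
  hasDerivWithinAt_Wt : ∀ t ∈ Ico 0 T, ∀ x ∈ Icc (0 : ℝ) 1,
    HasDerivWithinAt (Wt t) (Wtx t x) (Icc 0 1) x
  W_zero : ∀ x ∈ Icc (0 : ℝ) 1, W 0 x = 1
  Wt_zero : ∀ x ∈ Icc (0 : ℝ) 1, Wt 0 x = -F x
  W_pos : ∀ t ∈ Ico 0 T, ∀ x ∈ Icc (0 : ℝ) 1, 0 < W t x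
  integral_inv_W : ∀ t ∈ Ico 0 T, ∫ x in (0 : ℝ)..1, (W t x)⁻¹ = 1

namespace ReciprocalJacobian

variable {F R : ℝ → ℝ} {T t x y : ℝ}

/-- The flow `γ(t,x) = ∫₀ˣ dz / W(t,z)`. -/
noncomputable def flow (w : ReciprocalJacobian F R T) (t x : ℝ) : ℝ :=
  ∫ z in (0 : ℝ)..x, (w.W t z)⁻¹

/-- The back-to-labels map, inverse of `flow t` on `[0,1]`. -/
noncomputable def label (w : ReciprocalJacobian F R T) (t y : ℝ) : ℝ :=
  Function.invFunOn (w.flow t) (Icc 0 1) y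

/-- The Lagrangian velocity `γ_t(t,x)`. -/
noncomputable def flowVelocity (w : ReciprocalJacobian F R T) (t x : ℝ) : ℝ :=
  ∫ z in (0 : ℝ)..x, -w.Wt t z / w.W t z ^ 2

/-- The strain `f_x` in Lagrangian coordinates. -/
noncomputable def strain (w : ReciprocalJacobian F R T) (t x : ℝ) : ℝ :=
  -w.Wt t x / w.W t x

/-- The label derivative of `strain`. -/
noncomputable def strainX (w : ReciprocalJacobian F R T) (t x : ℝ) : ℝ :=
  (-w.Wtx t x * w.W t x - -w.Wt t x * w.Wx t x) / w.W t x ^ 2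

/-- The Eulerian velocity, the component `f` of the solution. -/
noncomputable def velocity (w : ReciprocalJacobian F R T) (t y : ℝ) : ℝ :=
  w.flowVelocity t (w.label t y)

/-- The density `ρ` in Lagrangian coordinates. -/
noncomputable def labelDensity (w : ReciprocalJacobian F R T) (t x : ℝ) : ℝ :=
  R x / w.W t x

/-- The label derivative of `labelDensity`. -/
noncomputable def labelDensityX (w : ReciprocalJacobian F R T) (t x : ℝ) : ℝ :=
  (dX R x * w.W t x - R x * w.Wx t x) / w.W t x ^ 2

/-- The Eulerian density, the component `ρ` of the solution. -/
noncomputable def density (w : ReciprocalJacobian F R T) (t y : ℝ) : ℝ :=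
  w.labelDensity t (w.label t y)

theorem W_ne_zero (w : ReciprocalJacobian F R T) (ht : t ∈ Ico 0 T) (hx : x ∈ Icc (0 : ℝ) 1) :
    w.W t x ≠ 0 :=
  (w.W_pos t ht x hx).ne'

theorem continuousOn_inv_W (w : ReciprocalJacobian F R T) :
    ContinuousOn (fun p : ℝ × ℝ => (w.W p.1 p.2)⁻¹) (Ico 0 T ×ˢ Icc 0 1) :=
  w.cont_W.inv₀ fun _ hp => w.W_ne_zero hp.1 hp.2

theorem flow_zero (w : ReciprocalJacobian F R T) (t : ℝ) : w.flow t 0 = 0 :=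
  intervalIntegral.integral_same

theorem flow_one (w : ReciprocalJacobian F R T) (ht : t ∈ Ico 0 T) : w.flow t 1 = 1 :=
  w.integral_inv_W t ht

theorem hasDerivWithinAt_flow (w : ReciprocalJacobian F R T) (ht : t ∈ Ico 0 T)
    (hx : x ∈ Icc (0 : ℝ) 1) : HasDerivWithinAt (w.flow t) (w.W t x)⁻¹ (Icc 0 1) x :=
  hasDerivWithinAt_integral_Icc (w.continuousOn_inv_W.uncurry_left (f := fun t x => (w.W t x)⁻¹)
    t ht) hx

theorem strictMonoOn_flow (w : ReciprocalJacobian F R T) (ht : t ∈ Ico 0 T) :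
    StrictMonoOn (w.flow t) (Icc 0 1) := by
  refine strictMonoOn_of_hasDerivWithinAt_pos (convex_Icc 0 1)
    (fun x hx => (w.hasDerivWithinAt_flow ht hx).continuousWithinAt)
    (fun x hx => (w.hasDerivWithinAt_flow ht (interior_subset hx)).mono interior_subset)
    fun x hx => inv_pos.2 (w.W_pos t ht x (interior_subset hx))

theorem bijOn_flow (w : ReciprocalJacobian F R T) (ht : t ∈ Ico 0 T) :
    BijOn (w.flow t) (Icc 0 1) (Icc 0 1) := by
  have hmono := w.strictMonoOn_flow ht
  have hcont : ContinuousOn (w.flow t) (Icc 0 1) := fun x hx =>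
    (w.hasDerivWithinAt_flow ht hx).continuousWithinAt
  have h := hmono.monotoneOn.mapsTo_Icc
  have hsurj := intermediate_value_Icc zero_le_one hcont
  rw [w.flow_zero, w.flow_one ht] at h hsurj
  exact ⟨h, hmono.injOn, hsurj⟩

theorem label_mem (w : ReciprocalJacobian F R T) (ht : t ∈ Ico 0 T) (hy : y ∈ Icc (0 : ℝ) 1) :
    w.label t y ∈ Icc (0 : ℝ) 1 :=
  (w.bijOn_flow ht).surjOn.mapsTo_invFunOn hy

theorem flow_label (w : ReciprocalJacobian F R T) (ht : t ∈ Ico 0 T) (hy : y ∈ Icc (0 : ℝ) 1) :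
    w.flow t (w.label t y) = y :=
  (w.bijOn_flow ht).invOn_invFunOn.2 hy

theorem label_flow (w : ReciprocalJacobian F R T) (ht : t ∈ Ico 0 T) (hx : x ∈ Icc (0 : ℝ) 1) :
    w.label t (w.flow t x) = x :=
  (w.bijOn_flow ht).invOn_invFunOn.1 hx

theorem label_left (w : ReciprocalJacobian F R T) (ht : t ∈ Ico 0 T) : w.label t 0 = 0 := by
  simpa only [w.flow_zero] using w.label_flow ht unitInterval.zero_mem

theorem label_right (w : ReciprocalJacobian F R T) (ht : t ∈ Ico 0 T) : w.label t 1 = 1 := by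
  simpa only [w.flow_one ht] using w.label_flow ht unitInterval.one_mem

theorem label_zero (w : ReciprocalJacobian F R T) (hT : 0 < T) (hy : y ∈ Icc (0 : ℝ) 1) :
    w.label 0 y = y := by
  have hflow : w.flow 0 y = y := by
    have hone : ∫ z in (0 : ℝ)..y, (w.W 0 z)⁻¹ = ∫ _ in (0 : ℝ)..y, (1 : ℝ) :=
      intervalIntegral.integral_congr fun z hz => by
        simp only [w.W_zero z (uIcc_subset_Icc_of_mem hy hz), inv_one]
    simpa [flow] using hone
  simpa only [hflow] using w.label_flow (left_mem_Ico.2 hT) hy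

theorem continuousOn_label (w : ReciprocalJacobian F R T) :
    ContinuousOn (fun p : ℝ × ℝ => w.label p.1 p.2) (Ico 0 T ×ˢ Icc 0 1) :=
  continuousOn_inverse_of_strictMonoOn (g := w.flow)
    (fun _ hx => continuousOn_parametric_integral_of_mem w.continuousOn_inv_W hx)
    (fun _ ht => w.strictMonoOn_flow ht) (fun _ ht _ hy => w.label_mem ht hy)
    fun _ ht _ hy => w.flow_label ht hy

theorem continuousOn_comp_label (w : ReciprocalJacobian F R T) {k : ℝ → ℝ → ℝ}
    (hk : ContinuousOn (fun p : ℝ × ℝ => k p.1 p.2) (Ico 0 T ×ˢ Icc 0 1)) :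
    ContinuousOn (fun p : ℝ × ℝ => k p.1 (w.label p.1 p.2)) (Ico 0 T ×ˢ Icc 0 1) :=
  hk.comp (continuousOn_fst.prodMk w.continuousOn_label) fun _ hp => ⟨hp.1, w.label_mem hp.1 hp.2⟩

theorem hasDerivWithinAt_label (w : ReciprocalJacobian F R T) (ht : t ∈ Ico 0 T)
    (hy : y ∈ Icc (0 : ℝ) 1) :
    HasDerivWithinAt (w.label t) (w.W t (w.label t y)) (Icc 0 1) y := by
  have hmem := w.label_mem ht hy
  rw [← inv_inv (w.W t _)]
  exact hasDerivWithinAt_of_leftInverse (fun z hz => w.label_mem ht hz)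
    (w.continuousOn_label.uncurry_left (f := w.label) t ht y hy) hy
    (w.hasDerivWithinAt_flow ht hmem) (inv_ne_zero (w.W_ne_zero ht hmem))
    fun z hz => w.flow_label ht hz

theorem hasDerivWithinAt_comp_label (w : ReciprocalJacobian F R T) {k : ℝ → ℝ} {k' : ℝ}
    (ht : t ∈ Ico 0 T) (hy : y ∈ Icc (0 : ℝ) 1)
    (hk : HasDerivWithinAt k k' (Icc 0 1) (w.label t y)) :
    HasDerivWithinAt (fun y => k (w.label t y)) (k' * w.W t (w.label t y)) (Icc 0 1) y :=
  hk.comp y (w.hasDerivWithinAt_label ht hy) fun _ hz => w.label_mem ht hz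

theorem integral_comp_label (w : ReciprocalJacobian F R T) (ht : t ∈ Ico 0 T) {k : ℝ → ℝ}
    (hk : ContinuousOn k (Icc 0 1)) :
    ∫ y in (0 : ℝ)..1, k (w.label t y) = ∫ x in (0 : ℝ)..1, k x / w.W t x := by
  have hmaps := (w.bijOn_flow ht).mapsTo
  have hmin : Ioo (min (0 : ℝ) 1) (max 0 1) = Ioo 0 1 := by simp
  have hlabel : ContinuousOn (w.label t) (Icc 0 1) :=
    w.continuousOn_label.uncurry_left (f := w.label) t ht
  have hsubst := intervalIntegral.integral_comp_mul_deriv'' (a := 0) (b := 1) (f := w.flow t)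
    (f' := fun x => (w.W t x)⁻¹) (g := fun y => k (w.label t y))
    (by rw [uIcc_of_le zero_le_one]
        exact fun x hx => (w.hasDerivWithinAt_flow ht hx).continuousWithinAt)
    (fun x hx => ((w.hasDerivWithinAt_flow ht (Ioo_subset_Icc_self (hmin ▸ hx))).hasDerivAt
      (Icc_mem_nhds (hmin ▸ hx).1 (hmin ▸ hx).2)).hasDerivWithinAt)
    (by rw [uIcc_of_le zero_le_one]
        exact w.continuousOn_inv_W.uncurry_left (f := fun t x => (w.W t x)⁻¹) t ht)
    (by rw [uIcc_of_le zero_le_one]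
        exact (hk.comp hlabel fun y hy => w.label_mem ht hy).mono hmaps.image_subset)
  rw [w.flow_zero, w.flow_one ht] at hsubst
  rw [← hsubst]
  refine intervalIntegral.integral_congr fun x hx => ?_
  rw [uIcc_of_le zero_le_one] at hx
  simp only [Function.comp_apply, w.label_flow ht hx, div_eq_mul_inv]

theorem hasDerivAt_flow (w : ReciprocalJacobian F R T) (ht : t ∈ Ioo 0 T)
    (hx : x ∈ Icc (0 : ℝ) 1) : HasDerivAt (fun s => w.flow s x) (w.flowVelocity t x) t :=
  have hsub : Ioo 0 T ×ˢ Icc (0 : ℝ) 1 ⊆ Ico 0 T ×ˢ Icc 0 1 := prod_mono_left Ioo_subset_Ico_self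
  hasDerivAt_integral_inv isOpen_Ioo (w.cont_W.mono hsub) (w.cont_Wt.mono hsub)
    (fun _ hs _ hz => w.W_ne_zero (Ioo_subset_Ico_self hs) hz) w.hasDerivAt_W ht hx

theorem hasDerivAt_label (w : ReciprocalJacobian F R T) (ht : t ∈ Ioo 0 T)
    (hy : y ∈ Icc (0 : ℝ) 1) :
    HasDerivAt (fun s => w.label s y) (-w.velocity t y * w.W t (w.label t y)) t := by
  have hI := Ioo_mem_nhds ht.1 ht.2
  have hIco : ∀ {s}, s ∈ Ioo 0 T → s ∈ Ico 0 T := fun hs => Ioo_subset_Ico_self hs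
  have hmem := w.label_mem (hIco ht) hy
  have hcont : ContinuousAt (fun s => w.label s y) t :=
    (w.continuousOn_label.uncurry_right (f := w.label) y hy).continuousAt
      (mem_of_superset hI Ioo_subset_Ico_self)
  rw [← div_inv_eq_mul]
  exact hasDerivAt_of_implicit (k := w.flow) (kx := fun t x => (w.W t x)⁻¹) hI
    (fun s hs x hx => w.hasDerivWithinAt_flow (hIco hs) hx)
    (w.continuousOn_inv_W.mono (prod_mono_left Ioo_subset_Ico_self))
    (fun s hs => w.label_mem (hIco hs) hy) hcont (fun s hs => w.flow_label (hIco hs) hy)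
    (w.hasDerivAt_flow ht hmem) (inv_ne_zero (w.W_ne_zero (hIco ht) hmem))

theorem hasDerivAt_comp_label (w : ReciprocalJacobian F R T) {k kx : ℝ → ℝ → ℝ} {k₁ : ℝ}
    (ht : t ∈ Ioo 0 T) (hy : y ∈ Icc (0 : ℝ) 1)
    (hkx : ContinuousOn (fun p : ℝ × ℝ => kx p.1 p.2) (Ico 0 T ×ˢ Icc 0 1))
    (hk : ∀ s ∈ Ico 0 T, ∀ x ∈ Icc (0 : ℝ) 1, HasDerivWithinAt (k s) (kx s x) (Icc 0 1) x)
    (hkt : HasDerivAt (fun s => k s (w.label t y)) k₁ t) :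
    HasDerivAt (fun s => k s (w.label s y))
      (k₁ - w.velocity t y * (kx t (w.label t y) * w.W t (w.label t y))) t :=
  (hasDerivAt_comp_moving_point (mem_of_superset (Ioo_mem_nhds ht.1 ht.2) Ioo_subset_Ico_self) hk
    hkx (fun s hs => w.label_mem hs hy) hkt (w.hasDerivAt_label ht hy)).congr_deriv (by ring)

theorem continuousOn_strain (w : ReciprocalJacobian F R T) :
    ContinuousOn (fun p : ℝ × ℝ => w.strain p.1 p.2) (Ico 0 T ×ˢ Icc 0 1) :=
  w.cont_Wt.neg.div w.cont_W fun _ hp => w.W_ne_zero hp.1 hp.2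

theorem continuousOn_strainX (w : ReciprocalJacobian F R T) :
    ContinuousOn (fun p : ℝ × ℝ => w.strainX p.1 p.2) (Ico 0 T ×ˢ Icc 0 1) :=
  ((w.cont_Wtx.neg.mul w.cont_W).sub (w.cont_Wt.neg.mul w.cont_Wx)).div (w.cont_W.pow 2)
    fun _ hp => pow_ne_zero 2 (w.W_ne_zero hp.1 hp.2)

theorem hasDerivWithinAt_strain (w : ReciprocalJacobian F R T) (ht : t ∈ Ico 0 T)
    (hx : x ∈ Icc (0 : ℝ) 1) : HasDerivWithinAt (w.strain t) (w.strainX t x) (Icc 0 1) x :=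
  (w.hasDerivWithinAt_Wt t ht x hx).fun_neg.fun_div (w.hasDerivWithinAt_W t ht x hx)
    (w.W_ne_zero ht hx)

theorem hasDerivAt_strain (w : ReciprocalJacobian F R T) (ht : t ∈ Ioo 0 T)
    (hx : x ∈ Icc (0 : ℝ) 1) :
    HasDerivAt (fun s => w.strain s x) (w.I t - w.labelDensity t x + w.strain t x ^ 2) t := by
  have hne := w.W_ne_zero (Ioo_subset_Ico_self ht) hx
  refine ((w.hasDerivAt_Wt t ht x hx).fun_neg.fun_div (w.hasDerivAt_W t ht x hx)
    hne).congr_deriv ?_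
  rw [strain, labelDensity]
  field_simp
  ring

theorem hasDerivWithinAt_velocity (w : ReciprocalJacobian F R T) (ht : t ∈ Ico 0 T)
    (hy : y ∈ Icc (0 : ℝ) 1) :
    HasDerivWithinAt (w.velocity t) (w.strain t (w.label t y)) (Icc 0 1) y := by
  have hmem := w.label_mem ht hy
  have hflow : HasDerivWithinAt (w.flowVelocity t)
      (-w.Wt t (w.label t y) / w.W t (w.label t y) ^ 2) (Icc 0 1) (w.label t y) :=
    hasDerivWithinAt_integral_Icc ((w.cont_Wt.uncurry_left t ht).neg.div
      ((w.cont_W.uncurry_left t ht).pow 2) fun x hx => pow_ne_zero 2 (w.W_ne_zero ht hx)) hmem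
  refine (w.hasDerivWithinAt_comp_label ht hy hflow).congr_deriv ?_
  have hne := w.W_ne_zero ht hmem
  rw [strain]
  field_simp

theorem dX_velocity (w : ReciprocalJacobian F R T) (ht : t ∈ Ico 0 T) (hy : y ∈ Icc (0 : ℝ) 1) :
    dX (w.velocity t) y = w.strain t (w.label t y) :=
  dX_eq_of_hasDerivWithinAt (w.hasDerivWithinAt_velocity ht hy) hy

theorem hasDerivWithinAt_dX_velocity (w : ReciprocalJacobian F R T) (ht : t ∈ Ico 0 T)
    (hy : y ∈ Icc (0 : ℝ) 1) :
    HasDerivWithinAt (dX (w.velocity t)) (w.strainX t (w.label t y) * w.W t (w.label t y))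
      (Icc 0 1) y :=
  (w.hasDerivWithinAt_comp_label ht hy (w.hasDerivWithinAt_strain ht (w.label_mem ht hy))).congr
    (fun _ hz => w.dX_velocity ht hz) (w.dX_velocity ht hy)

theorem hasDerivAt_dX_velocity (w : ReciprocalJacobian F R T) (ht : t ∈ Ioo 0 T)
    (hy : y ∈ Icc (0 : ℝ) 1) :
    HasDerivAt (fun s => dX (w.velocity s) y)
      (w.I t - w.density t y + dX (w.velocity t) y ^ 2
        - w.velocity t y * dX (dX (w.velocity t)) y) t := by
  have ht' := Ioo_subset_Ico_self ht
  rw [w.dX_velocity ht' hy, dX_eq_of_hasDerivWithinAt (w.hasDerivWithinAt_dX_velocity ht' hy) hy]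
  refine (w.hasDerivAt_comp_label ht hy w.continuousOn_strainX
    (fun s hs x hx => w.hasDerivWithinAt_strain hs hx)
    (w.hasDerivAt_strain ht (w.label_mem ht' hy))).congr_of_eventuallyEq ?_
  filter_upwards [Ioo_mem_nhds ht.1 ht.2] with s hs using w.dX_velocity (Ioo_subset_Ico_self hs) hy

theorem continuousOn_labelDensity (w : ReciprocalJacobian F R T) :
    ContinuousOn (fun p : ℝ × ℝ => w.labelDensity p.1 p.2) (Ico 0 T ×ˢ Icc 0 1) :=
  (w.cont_R.comp continuousOn_snd fun _ hp => hp.2).div w.cont_W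
    fun _ hp => w.W_ne_zero hp.1 hp.2

theorem continuousOn_labelDensityX (w : ReciprocalJacobian F R T)
    (hR' : ContinuousOn (dX R) (Icc 0 1)) :
    ContinuousOn (fun p : ℝ × ℝ => w.labelDensityX p.1 p.2) (Ico 0 T ×ˢ Icc 0 1) :=
  (((hR'.comp continuousOn_snd fun _ hp => hp.2).mul w.cont_W).sub
    ((w.cont_R.comp continuousOn_snd fun _ hp => hp.2).mul w.cont_Wx)).div (w.cont_W.pow 2)
    fun _ hp => pow_ne_zero 2 (w.W_ne_zero hp.1 hp.2)

theorem hasDerivWithinAt_labelDensity (w : ReciprocalJacobian F R T)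
    (hR : DifferentiableOn ℝ R (Icc 0 1)) (ht : t ∈ Ico 0 T) (hx : x ∈ Icc (0 : ℝ) 1) :
    HasDerivWithinAt (w.labelDensity t) (w.labelDensityX t x) (Icc 0 1) x :=
  (hR x hx).hasDerivWithinAt.fun_div (w.hasDerivWithinAt_W t ht x hx) (w.W_ne_zero ht hx)

theorem hasDerivAt_labelDensity (w : ReciprocalJacobian F R T) (ht : t ∈ Ioo 0 T)
    (hx : x ∈ Icc (0 : ℝ) 1) :
    HasDerivAt (fun s => w.labelDensity s x) (w.labelDensity t x * w.strain t x) t := by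
  have hne := w.W_ne_zero (Ioo_subset_Ico_self ht) hx
  refine ((hasDerivAt_const t (R x)).fun_div (w.hasDerivAt_W t ht x hx) hne).congr_deriv ?_
  rw [strain, labelDensity]
  field_simp
  ring

theorem hasDerivWithinAt_density (w : ReciprocalJacobian F R T)
    (hR : DifferentiableOn ℝ R (Icc 0 1)) (ht : t ∈ Ico 0 T) (hy : y ∈ Icc (0 : ℝ) 1) :
    HasDerivWithinAt (w.density t) (w.labelDensityX t (w.label t y) * w.W t (w.label t y))
      (Icc 0 1) y :=
  w.hasDerivWithinAt_comp_label ht hy (w.hasDerivWithinAt_labelDensity hR ht (w.label_mem ht hy))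

theorem hasDerivAt_density (w : ReciprocalJacobian F R T) (hR : DifferentiableOn ℝ R (Icc 0 1))
    (hR' : ContinuousOn (dX R) (Icc 0 1)) (ht : t ∈ Ioo 0 T) (hy : y ∈ Icc (0 : ℝ) 1) :
    HasDerivAt (fun s => w.density s y)
      (w.density t y * dX (w.velocity t) y - w.velocity t y * dX (w.density t) y) t := by
  have ht' := Ioo_subset_Ico_self ht
  rw [w.dX_velocity ht' hy, dX_eq_of_hasDerivWithinAt (w.hasDerivWithinAt_density hR ht' hy) hy]
  exact w.hasDerivAt_comp_label ht hy (w.continuousOn_labelDensityX hR')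
    (fun s hs x hx => w.hasDerivWithinAt_labelDensity hR hs hx)
    (w.hasDerivAt_labelDensity ht (w.label_mem ht' hy))

theorem flowVelocity_one (w : ReciprocalJacobian F R T) (ht : t ∈ Ioo 0 T) :
    w.flowVelocity t 1 = 0 := by
  refine (w.hasDerivAt_flow ht unitInterval.one_mem).unique
    ((hasDerivAt_const t (1 : ℝ)).congr_of_eventuallyEq ?_)
  filter_upwards [Ioo_mem_nhds ht.1 ht.2] with s hs using w.flow_one (Ioo_subset_Ico_self hs)

theorem integral_deriv_flowVelocity_one (w : ReciprocalJacobian F R T) (ht : t ∈ Ioo 0 T) :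
    ∫ x in (0 : ℝ)..1, (2 * w.Wt t x ^ 2 / w.W t x ^ 3 - (R x - w.I t * w.W t x) / w.W t x ^ 2)
      = 0 := by
  have hsub : Ioo 0 T ×ˢ Icc (0 : ℝ) 1 ⊆ Ico 0 T ×ˢ Icc 0 1 := prod_mono_left Ioo_subset_Ico_self
  have hWtt : ContinuousOn (fun p : ℝ × ℝ => R p.2 - w.I p.1 * w.W p.1 p.2)
      (Ioo 0 T ×ˢ Icc 0 1) :=
    (w.cont_R.comp continuousOn_snd fun _ hp => hp.2).sub
      ((w.cont_I.comp continuousOn_fst fun _ hp => hp.1).mul (w.cont_W.mono hsub))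
  refine (hasDerivAt_integral_neg_div_sq (u₂ := fun t x => R x - w.I t * w.W t x) isOpen_Ioo
    (w.cont_W.mono hsub) (w.cont_Wt.mono hsub) hWtt
    (fun s hs x hx => w.W_ne_zero (Ioo_subset_Ico_self hs) hx) w.hasDerivAt_W w.hasDerivAt_Wt ht
    unitInterval.one_mem).unique ((hasDerivAt_const t (0 : ℝ)).congr_of_eventuallyEq ?_)
  filter_upwards [Ioo_mem_nhds ht.1 ht.2] with s hs using w.flowVelocity_one hs

theorem nonlocalI_velocity_density (w : ReciprocalJacobian F R T) (ht : t ∈ Ioo 0 T) :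
    nonlocalI (w.velocity t) (w.density t) = w.I t := by
  have ht' := Ioo_subset_Ico_self ht
  have hne : ∀ x ∈ Icc (0 : ℝ) 1, w.W t x ≠ 0 := fun _ hx => w.W_ne_zero ht' hx
  have cW := w.cont_W.uncurry_left t ht'
  have cr : ContinuousOn (w.labelDensity t) (Icc 0 1) :=
    w.continuousOn_labelDensity.uncurry_left (f := w.labelDensity) t ht'
  have cq : ContinuousOn (fun x => w.strain t x ^ 2) (Icc 0 1) :=
    (w.continuousOn_strain.uncurry_left (f := w.strain) t ht').pow 2
  have ii : ∀ {v : ℝ → ℝ}, ContinuousOn v (Icc 0 1) → IntervalIntegrable v volume 0 1 :=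
    fun hv => hv.intervalIntegrable_of_Icc zero_le_one
  have irW : IntervalIntegrable (fun x => w.labelDensity t x / w.W t x) volume 0 1 :=
    ii (cr.div cW hne)
  have iqW : IntervalIntegrable (fun x => 2 * (w.strain t x ^ 2 / w.W t x)) volume 0 1 :=
    ii ((cq.div cW hne).const_mul 2)
  have iI : IntervalIntegrable (fun x => w.I t * (w.W t x)⁻¹) volume 0 1 :=
    ii ((cW.inv₀ hne).const_mul _)
  have hdensity : ∫ y in (0 : ℝ)..1, w.density t y
      = ∫ x in (0 : ℝ)..1, w.labelDensity t x / w.W t x := w.integral_comp_label ht' cr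
  have hvelocity : ∫ y in (0 : ℝ)..1, dX (w.velocity t) y ^ 2
      = ∫ x in (0 : ℝ)..1, w.strain t x ^ 2 / w.W t x := by
    rw [← w.integral_comp_label ht' cq]
    refine intervalIntegral.integral_congr fun y hy => ?_
    rw [uIcc_of_le zero_le_one] at hy
    simp only [w.dX_velocity ht' hy]
  have hbalance : (2 * ∫ x in (0 : ℝ)..1, w.strain t x ^ 2 / w.W t x)
      - (∫ x in (0 : ℝ)..1, w.labelDensity t x / w.W t x) + w.I t = 0 := by
    have hI : w.I t = ∫ x in (0 : ℝ)..1, w.I t * (w.W t x)⁻¹ := by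
      rw [intervalIntegral.integral_const_mul, w.integral_inv_W t ht', mul_one]
    refine Eq.trans ?_ (w.integral_deriv_flowVelocity_one ht)
    rw [← intervalIntegral.integral_const_mul, ← intervalIntegral.integral_sub iqW irW, hI,
      ← intervalIntegral.integral_add (iqW.sub irW) iI, ← hI]
    refine intervalIntegral.integral_congr fun x hx => ?_
    have hx0 := hne x (uIcc_of_le (zero_le_one' ℝ) ▸ hx)
    simp only [labelDensity, strain]
    field_simp
    ring
  rw [nonlocalI, hvelocity, hdensity]
  linarith

theorem velocity_zero {f₀ : ℝ → ℝ} (w : ReciprocalJacobian (dX f₀) R T) (hT : 0 < T)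
    (hf₀ : DifferentiableOn ℝ f₀ (Icc 0 1)) (hF : ContinuousOn (dX f₀) (Icc 0 1)) (hf0 : f₀ 0 = 0)
    (hy : y ∈ Icc (0 : ℝ) 1) : w.velocity 0 y = f₀ y := by
  calc w.velocity 0 y = ∫ x in (0 : ℝ)..y, dX f₀ x := by
        rw [velocity, w.label_zero hT hy]
        refine intervalIntegral.integral_congr fun x hx => ?_
        have hx := uIcc_subset_Icc_of_mem hy hx
        simp [w.W_zero x hx, w.Wt_zero x hx]
    _ = f₀ y := by
        rw [integral_eq_sub_of_hasDerivWithinAt_Icc (u' := dX f₀)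
          (fun x hx => (hf₀ x hx).hasDerivWithinAt) hF hy, hf0, sub_zero]

theorem isDirichletSolution {f₀ : ℝ → ℝ} (w : ReciprocalJacobian (dX f₀) R T) (hT : 0 < T)
    (hf₀ : DifferentiableOn ℝ f₀ (Icc 0 1)) (hF : ContinuousOn (dX f₀) (Icc 0 1))
    (hf₀_bdry : f₀ 0 = 0 ∧ f₀ 1 = 0) (hR : DifferentiableOn ℝ R (Icc 0 1))
    (hR' : ContinuousOn (dX R) (Icc 0 1)) (hR_bdry : R 0 = 0 ∧ R 1 = 0) :
    IsDirichletSolution f₀ R T w.velocity w.density := by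
  have hvel : ContinuousOn (fun p : ℝ × ℝ => w.flowVelocity p.1 p.2) (Ico 0 T ×ˢ Icc 0 1) :=
    continuousOn_parametric_integral (h := fun t x => -w.Wt t x / w.W t x ^ 2)
      (w.cont_Wt.neg.div (w.cont_W.pow 2) fun _ hp => pow_ne_zero 2 (w.W_ne_zero hp.1 hp.2))
  refine ⟨fun t ht y hy => (w.hasDerivWithinAt_velocity ht hy).differentiableWithinAt,
    fun t ht y hy => (w.hasDerivWithinAt_dX_velocity ht hy).differentiableWithinAt,
    fun t ht y hy => (w.hasDerivWithinAt_density hR ht hy).differentiableWithinAt,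
    w.continuousOn_comp_label hvel, ?_, ?_, w.continuousOn_comp_label w.continuousOn_labelDensity,
    ?_, fun t ht y hy => (w.hasDerivAt_dX_velocity ht hy).differentiableAt,
    fun t ht y hy => (w.hasDerivAt_density hR hR' ht hy).differentiableAt, fun t ht y hy => ?_,
    fun t ht y hy => ?_, fun y hy => w.velocity_zero hT hf₀ hF hf₀_bdry.1 hy, fun y hy => ?_,
    fun t ht => ⟨?_, ?_⟩, fun t ht => ?_⟩
  · exact (w.continuousOn_comp_label w.continuousOn_strain).congr
      fun p hp => w.dX_velocity hp.1 hp.2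
  · exact (w.continuousOn_comp_label (k := fun t x => w.strainX t x * w.W t x)
      (w.continuousOn_strainX.mul w.cont_W)).congr fun p hp =>
        dX_eq_of_hasDerivWithinAt (w.hasDerivWithinAt_dX_velocity hp.1 hp.2) hp.2
  · exact (w.continuousOn_comp_label (k := fun t x => w.labelDensityX t x * w.W t x)
      ((w.continuousOn_labelDensityX hR').mul w.cont_W)).congr fun p hp =>
        dX_eq_of_hasDerivWithinAt (w.hasDerivWithinAt_density hR hp.1 hp.2) hp.2
  · rw [(w.hasDerivAt_dX_velocity ht hy).deriv, w.nonlocalI_velocity_density ht]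
    ring
  · rw [(w.hasDerivAt_density hR hR' ht hy).deriv]
    ring
  · simp [density, labelDensity, w.label_zero hT hy, w.W_zero y hy]
  · simp [velocity, flowVelocity, w.label_left ht]
  · rcases ht.1.eq_or_lt with rfl | h0
    · rw [w.velocity_zero hT hf₀ hF hf₀_bdry.1 unitInterval.one_mem, hf₀_bdry.2]
    · rw [velocity, w.label_right ht, w.flowVelocity_one ⟨h0, ht.2⟩]
  · simp [density, labelDensity, w.label_left ht, w.label_right ht, hR_bdry]

theorem integral_dX_velocity_eq_neg_log (w : ReciprocalJacobian F R T) (ht : t ∈ Ico 0 T)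
    (hx : x = 0 ∨ x = 1) :
    ∫ s in (0 : ℝ)..t, dX (w.velocity s) x = -Real.log (w.W t x) := by
  have hmem : x ∈ Icc (0 : ℝ) 1 := by rcases hx with rfl | rfl <;> simp
  have hsub : Icc 0 t ⊆ Ico 0 T := Icc_subset_Ico_right ht.2
  have hstrain : ∀ s ∈ Ico 0 T, dX (w.velocity s) x = w.strain s x := fun s hs => by
    rw [w.dX_velocity hs hmem]
    rcases hx with rfl | rfl
    exacts [by rw [w.label_left hs], by rw [w.label_right hs]]
  calc ∫ s in (0 : ℝ)..t, dX (w.velocity s) x = ∫ s in (0 : ℝ)..t, w.strain s x :=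
        intervalIntegral.integral_congr fun s hs =>
          hstrain s (hsub (uIcc_of_le ht.1 ▸ hs))
    _ = -Real.log (w.W t x) - -Real.log (w.W 0 x) := by
        refine intervalIntegral.integral_eq_sub_of_hasDerivAt_of_le
          (f := fun s => -Real.log (w.W s x)) ht.1 ?_ (fun s hs => ?_) ?_
        · exact (((w.cont_W.uncurry_right x hmem).mono hsub).log
            fun s hs => w.W_ne_zero (hsub hs) hmem).neg
        · have hs' : s ∈ Ioo 0 T := ⟨hs.1, hs.2.trans ht.2⟩
          refine (((w.hasDerivAt_W s hs' x hmem).log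
            (w.W_ne_zero (Ioo_subset_Ico_self hs') hmem)).fun_neg).congr_deriv ?_
          rw [strain, neg_div]
        · exact ((w.continuousOn_strain.uncurry_right (f := w.strain) x hmem).mono
            hsub).intervalIntegrable_of_Icc ht.1
    _ = -Real.log (w.W t x) := by rw [w.W_zero x hmem, Real.log_one, neg_zero, sub_zero]

end ReciprocalJacobian

section SecondOrderODE

open scoped NNReal

variable {E : Type*} [NormedAddCommGroup E] [NormedSpace ℝ E]

theorem eqOn_Icc_of_hasDerivWithinAt_ode {v : ℝ → E → E} {K : ℝ≥0} {α β : ℝ → E} {a c c' : ℝ}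
    (hlip : ∀ t ∈ Icc a c, LipschitzWith K (v t)) (hcc' : c ≤ c')
    (hα : ∀ t ∈ Icc a c, HasDerivWithinAt α (v t (α t)) (Icc a c) t)
    (hβ : ∀ t ∈ Icc a c', HasDerivWithinAt β (v t (β t)) (Icc a c') t) (h : α a = β a) :
    EqOn α β (Icc a c) := by
  have hright : ∀ {γ : ℝ → E} {d : ℝ},
      (∀ t ∈ Icc a d, HasDerivWithinAt γ (v t (γ t)) (Icc a d) t) →
      ∀ t ∈ Ico a d, HasDerivWithinAt γ (v t (γ t)) (Ici t) t := fun hγ t ht =>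
    (hγ t ⟨ht.1, ht.2.le⟩).mono_of_mem_nhdsWithin (mem_of_superset
      (Icc_mem_nhdsGE ht.2) (Icc_subset_Icc_left ht.1))
  have hsub : Icc a c ⊆ Icc a c' := Icc_subset_Icc_right hcc'
  exact ODE_solution_unique_of_mem_Icc_right (v := v) (s := fun _ => univ) (K := K)
    (fun t ht => (hlip t (Ico_subset_Icc_self ht)).lipschitzOnWith)
    (fun t ht => (hα t ht).continuousWithinAt) (hright hα) (fun _ _ => mem_univ _)
    (fun t ht => (hβ t (hsub ht)).continuousWithinAt.mono hsub)
    (fun t ht => hright hβ t ⟨ht.1, ht.2.trans_le hcc'⟩) (fun _ _ => mem_univ _) h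

theorem exists_solution_Ico_of_forall_Icc {v : ℝ → E → E} {a b : ℝ} {x₀ : E} (hab : a < b)
    (hlip : ∀ c < b, ∃ K : ℝ≥0, ∀ t ∈ Icc a c, LipschitzWith K (v t))
    (hex : ∀ c, a < c → c < b → ∃ α : ℝ → E, α a = x₀ ∧
      ∀ t ∈ Icc a c, HasDerivWithinAt α (v t (α t)) (Icc a c) t) :
    ∃ α : ℝ → E, α a = x₀ ∧ ∀ t ∈ Ico a b, HasDerivWithinAt α (v t (α t)) (Ico a b) t := by
  choose! α hα₀ hα using hex
  have hagree : ∀ c c', a < c → c ≤ c' → c' < b → EqOn (α c) (α c') (Icc a c) := by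
    intro c c' hac hcc' hcb'
    have hcb := hcc'.trans_lt hcb'
    have hac' := hac.trans_le hcc'
    obtain ⟨K, hK⟩ := hlip c hcb
    exact eqOn_Icc_of_hasDerivWithinAt_ode hK hcc' (hα c hac hcb) (hα c' hac' hcb')
      (by rw [hα₀ c hac hcb, hα₀ c' hac' hcb'])
  have hmid : ∀ t ∈ Ico a b, a < (t + b) / 2 ∧ t < (t + b) / 2 ∧ (t + b) / 2 < b :=
    fun t ht => ⟨by linarith [ht.1, ht.2], by linarith [ht.2], by linarith [ht.2]⟩
  have hlocal : ∀ c, a < c → c < b → ∀ t ∈ Ico a c, α ((t + b) / 2) t = α c t := by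
    intro c hac hcb t ht
    obtain ⟨h₁, h₂, h₃⟩ := hmid t ⟨ht.1, ht.2.trans hcb⟩
    rcases le_total c ((t + b) / 2) with h | h
    exacts [(hagree c _ hac h h₃ ⟨ht.1, ht.2.le⟩).symm, hagree _ c h₁ h hcb ⟨ht.1, h₂.le⟩]
  refine ⟨fun t => α ((t + b) / 2) t, ?_, fun t ht => ?_⟩
  · obtain ⟨h₁, -, h₃⟩ := hmid a (left_mem_Ico.2 hab)
    exact hα₀ _ h₁ h₃
  · obtain ⟨h₁, h₂, h₃⟩ := hmid t ht
    have hnear : Ico a ((t + b) / 2) ∈ 𝓝[Ico a b] t :=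
      mem_nhdsWithin.2 ⟨Iio ((t + b) / 2), isOpen_Iio, h₂, fun s hs => ⟨hs.2.1, hs.1⟩⟩
    refine ((hα _ h₁ h₃ t ⟨ht.1, h₂.le⟩).mono_of_mem_nhdsWithin
      (mem_of_superset hnear Ico_subset_Icc_self)).congr_of_eventuallyEq ?_ rfl
    filter_upwards [hnear] with s hs using hlocal _ h₁ h₃ s hs

variable [CompleteSpace E] {g : ℝ → E → E} {b c : ℝ}

/-- The velocity component is `c` times the derivative, which makes the field small enough for a
single Picard–Lindelöf step to cover `[0,c]`. -/
theorem exists_scaled_second_order_solution_Icc {K G : ℝ≥0} (hc : 0 < c)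
    (hlip : ∀ t ∈ Icc 0 c, LipschitzWith K (g t))
    (hcont : ∀ q, ContinuousOn (fun t => g t q) (Icc 0 c))
    (hG : ∀ t ∈ Icc 0 c, ∀ q, ‖g t q‖ ≤ G) :
    ∃ z : ℝ → E × E, z 0 = 0 ∧
      ∀ t ∈ Icc 0 c, HasDerivWithinAt z (c⁻¹ • (z t).2, c • g t (z t).1) (Icc 0 c) t := by
  lift c to ℝ≥0 using hc.le
  have hPL : IsPicardLindelof (fun t (z : E × E) => ((c : ℝ)⁻¹ • z.2, (c : ℝ) • g t z.1))
      (⟨0, left_mem_Icc.2 hc.le⟩ : Icc (0 : ℝ) c) 0 (c ^ 2 * G) 0 (c * G)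
      (max (‖(c : ℝ)⁻¹‖₊ * 1) (‖(c : ℝ)‖₊ * (K * 1))) := by
    refine ⟨fun t ht => LipschitzWith.lipschitzOnWith ?_, fun z _ => ?_, fun t ht z hz => ?_, ?_⟩
    · exact ((lipschitzWith_smul (c : ℝ)⁻¹).comp LipschitzWith.prod_snd).prodMk
        ((lipschitzWith_smul (c : ℝ)).comp ((hlip t ht).comp LipschitzWith.prod_fst))
    · exact continuousOn_const.prodMk ((hcont z.1).const_smul _)
    · rw [mem_closedBall_zero_iff] at hz
      refine max_le ?_ ?_
      · rw [norm_smul, norm_inv, Real.norm_of_nonneg hc.le, inv_mul_le_iff₀ hc]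
        refine ((norm_snd_le z).trans hz).trans_eq ?_
        push_cast
        ring
      · rw [norm_smul, Real.norm_of_nonneg hc.le, NNReal.coe_mul]
        exact mul_le_mul_of_nonneg_left (hG t ht _) hc.le
    · simp only [sub_zero, sub_self, max_eq_left hc.le, NNReal.coe_mul, NNReal.coe_pow,
        NNReal.coe_zero]
      exact le_of_eq (by ring)
  exact hPL.exists_eq_forall_mem_Icc_hasDerivWithinAt₀

theorem exists_second_order_solution (hb : 0 < b)
    (hlip : ∀ c < b, ∃ K : ℝ≥0, ∀ t ∈ Icc 0 c, LipschitzWith K (g t))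
    (hcont : ∀ q, ContinuousOn (fun t => g t q) (Ico 0 b))
    (hG : ∀ c < b, ∃ G : ℝ≥0, ∀ t ∈ Icc 0 c, ∀ q, ‖g t q‖ ≤ G) :
    ∃ Q Q₁ : ℝ → E, Q 0 = 0 ∧ Q₁ 0 = 0 ∧
      (∀ t ∈ Ico 0 b, HasDerivWithinAt Q (Q₁ t) (Ico 0 b) t) ∧
      ∀ t ∈ Ico 0 b, HasDerivWithinAt Q₁ (g t (Q t)) (Ico 0 b) t := by
  obtain ⟨z, hz₀, hz⟩ := exists_solution_Ico_of_forall_Icc (x₀ := (0 : E × E))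
    (v := fun t z => (z.2, g t z.1)) hb
    (fun c hc => by
      obtain ⟨K, hK⟩ := hlip c hc
      exact ⟨_, fun t ht => LipschitzWith.prod_snd.prodMk ((hK t ht).comp LipschitzWith.prod_fst)⟩)
    (fun c hc hcb => by
      obtain ⟨K, hK⟩ := hlip c hcb
      obtain ⟨G, hG⟩ := hG c hcb
      obtain ⟨z, hz₀, hz⟩ := exists_scaled_second_order_solution_Icc hc hK
        (fun q => (hcont q).mono (Icc_subset_Ico_right hcb)) hG
      refine ⟨fun t => ((z t).1, c⁻¹ • (z t).2), by simp [hz₀], fun t ht => ?_⟩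
      have hposition : HasDerivWithinAt (fun t => (z t).1) (c⁻¹ • (z t).2) (Icc 0 c) t :=
        (hz t ht).fst
      have hvelocity : HasDerivWithinAt (fun t => (z t).2) (c • g t (z t).1) (Icc 0 c) t :=
        (hz t ht).snd
      refine (hposition.prodMk (hvelocity.fun_const_smul c⁻¹)).congr_deriv ?_
      rw [inv_smul_smul₀ hc.ne'])
  exact ⟨fun t => (z t).1, fun t => (z t).2, by simp [hz₀], by simp [hz₀],
    fun t ht => (hz t ht).fst, fun t ht => (hz t ht).snd⟩

end SecondOrderODE

/-- The reciprocal Jacobian of the flow, before normalization to unit mass and change of time, as a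
function of the new time `η` and the forcing weight `q`. -/
noncomputable def profile (F R : ℝ → ℝ) (η q x : ℝ) : ℝ :=
  1 - η * F x + q * R x

/-- The mass `∫₀¹ dx / (1 - η F + q R)`, the normalizing factor of `profile`. -/
noncomputable def profileMass (F R : ℝ → ℝ) (η q : ℝ) : ℝ :=
  ∫ x in (0 : ℝ)..1, (profile F R η q x)⁻¹

/-- A solution `Q` of `Q'' = profileMass(η, Q)³` on `[0, 1/M)` at rest at `η = 0`, with `Q₁ = Q'`,
together with the standing assumptions `F ≤ M` and `0 ≤ R`. -/
structure ProfileWeight (F R : ℝ → ℝ) (M : ℝ) where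
  Q : ℝ → ℝ
  Q₁ : ℝ → ℝ
  cont_F : ContinuousOn F (Icc 0 1)
  cont_R : ContinuousOn R (Icc 0 1)
  F_le : ∀ x ∈ Icc (0 : ℝ) 1, F x ≤ M
  R_nonneg : ∀ x ∈ Icc (0 : ℝ) 1, 0 ≤ R x
  M_pos : 0 < M
  Q_zero : Q 0 = 0
  Q₁_zero : Q₁ 0 = 0
  hasDerivWithinAt_Q : ∀ η ∈ Ico 0 (1 / M), HasDerivWithinAt Q (Q₁ η) (Ico 0 (1 / M)) η
  hasDerivWithinAt_Q₁ : ∀ η ∈ Ico 0 (1 / M),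
    HasDerivWithinAt Q₁ (profileMass F R η (Q η) ^ 3) (Ico 0 (1 / M)) η
  Q_nonneg : ∀ η ∈ Ico 0 (1 / M), 0 ≤ Q η

section Profile

open scoped NNReal

variable {F R : ℝ → ℝ} {M η q c x : ℝ}

theorem one_sub_mul_pos_of_lt_one_div (hM : 0 < M) (hc : c < 1 / M) : 0 < 1 - c * M :=
  sub_pos.2 ((lt_div_iff₀ hM).1 hc)

theorem one_sub_mul_le_profile (hF : F x ≤ M) (hR : 0 ≤ R x) (hη : 0 ≤ η) (hq : 0 ≤ q) :
    1 - η * M ≤ profile F R η q x := by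
  have hηF := mul_le_mul_of_nonneg_left hF hη
  have hqR := mul_nonneg hq hR
  rw [profile]
  linarith

theorem continuousOn_profile {S : Set ℝ} {Q : ℝ → ℝ} (hF : ContinuousOn F (Icc 0 1))
    (hR : ContinuousOn R (Icc 0 1)) (hQ : ContinuousOn Q S) :
    ContinuousOn (fun p : ℝ × ℝ => profile F R p.1 (Q p.1) p.2) (S ×ˢ Icc 0 1) :=
  (continuousOn_const.sub (continuousOn_fst.mul (hF.comp continuousOn_snd fun _ hp => hp.2))).add
    ((hQ.comp continuousOn_fst fun _ hp => hp.1).mul (hR.comp continuousOn_snd fun _ hp => hp.2))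

theorem continuousOn_profile_slice (hF : ContinuousOn F (Icc 0 1))
    (hR : ContinuousOn R (Icc 0 1)) : ContinuousOn (profile F R η q) (Icc 0 1) :=
  (continuousOn_const.sub (hF.const_mul η)).add (hR.const_mul q)

variable (hcF : ContinuousOn F (Icc 0 1)) (hcR : ContinuousOn R (Icc 0 1))
  (hF : ∀ x ∈ Icc (0 : ℝ) 1, F x ≤ M) (hR : ∀ x ∈ Icc (0 : ℝ) 1, 0 ≤ R x)
  (hM : 0 < M)

include hF hR hM in
theorem profile_pos (hη : η ∈ Ico 0 (1 / M)) (hq : 0 ≤ q) (hx : x ∈ Icc (0 : ℝ) 1) :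
    0 < profile F R η q x :=
  (one_sub_mul_pos_of_lt_one_div hM hη.2).trans_le
    (one_sub_mul_le_profile (hF x hx) (hR x hx) hη.1 hq)

include hF hR hM in
theorem one_sub_mul_le_profile_of_le (hη : η ∈ Icc 0 c) (hq : 0 ≤ q) (hx : x ∈ Icc (0 : ℝ) 1) :
    1 - c * M ≤ profile F R η q x :=
  (sub_le_sub_left (mul_le_mul_of_nonneg_right hη.2 hM.le) 1).trans
    (one_sub_mul_le_profile (hF x hx) (hR x hx) hη.1 hq)

include hcF hcR hF hR hM

theorem continuousOn_inv_profile_slice (hη : η ∈ Ico 0 (1 / M)) (hq : 0 ≤ q) :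
    ContinuousOn (fun x => (profile F R η q x)⁻¹) (Icc 0 1) :=
  (continuousOn_profile_slice hcF hcR).inv₀ fun _ hx => (profile_pos hF hR hM hη hq hx).ne'

theorem continuousOn_profileMass {S : Set ℝ} {Q : ℝ → ℝ} (hS : S ⊆ Ico 0 (1 / M))
    (hQ : ContinuousOn Q S) (hQ₀ : ∀ η ∈ S, 0 ≤ Q η) :
    ContinuousOn (fun η => profileMass F R η (Q η)) S :=
  continuousOn_parametric_integral_of_mem (h := fun η x => (profile F R η (Q η) x)⁻¹)
    ((continuousOn_profile hcF hcR hQ).inv₀ fun p hp =>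
      (profile_pos hF hR hM (hS hp.1) (hQ₀ p.1 hp.1) hp.2).ne') unitInterval.one_mem

theorem profileMass_pos (hη : η ∈ Ico 0 (1 / M)) (hq : 0 ≤ q) : 0 < profileMass F R η q :=
  intervalIntegral.integral_pos zero_lt_one (continuousOn_inv_profile_slice hcF hcR hF hR hM hη hq)
    (fun _ hx => (inv_pos.2 (profile_pos hF hR hM hη hq (Ioc_subset_Icc_self hx))).le)
    ⟨0, unitInterval.zero_mem, inv_pos.2 (profile_pos hF hR hM hη hq unitInterval.zero_mem)⟩

theorem profileMass_le_inv (hc : c < 1 / M) (hη : η ∈ Icc 0 c) (hq : 0 ≤ q) :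
    profileMass F R η q ≤ (1 - c * M)⁻¹ := by
  refine (intervalIntegral.integral_mono_on (g := fun _ => (1 - c * M)⁻¹) zero_le_one
    ((continuousOn_inv_profile_slice hcF hcR hF hR hM ⟨hη.1, hη.2.trans_lt hc⟩
      hq).intervalIntegrable_of_Icc zero_le_one) intervalIntegrable_const
    fun x hx => ?_).trans_eq (by simp)
  exact inv_anti₀ (one_sub_mul_pos_of_lt_one_div hM hc)
    (one_sub_mul_le_profile_of_le hF hR hM hη hq hx)

theorem abs_profileMass_sub_le {N q₁ q₂ : ℝ} (hN : ∀ x ∈ Icc (0 : ℝ) 1, R x ≤ N) (hc : c < 1 / M)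
    (hη : η ∈ Icc 0 c) (hq₁ : 0 ≤ q₁) (hq₂ : 0 ≤ q₂) :
    |profileMass F R η q₁ - profileMass F R η q₂| ≤ N / (1 - c * M) ^ 2 * |q₁ - q₂| := by
  have hη' : η ∈ Ico 0 (1 / M) := ⟨hη.1, hη.2.trans_lt hc⟩
  have hm := one_sub_mul_pos_of_lt_one_div hM hc
  have hint : ∀ {q}, 0 ≤ q → IntervalIntegrable (fun x => (profile F R η q x)⁻¹) volume 0 1 :=
    fun hq => (continuousOn_inv_profile_slice hcF hcR hF hR hM hη'
      hq).intervalIntegrable_of_Icc zero_le_one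
  rw [profileMass, profileMass, ← intervalIntegral.integral_sub (hint hq₁) (hint hq₂)]
  suffices hbound : ∀ x ∈ uIoc (0 : ℝ) 1,
      ‖(profile F R η q₁ x)⁻¹ - (profile F R η q₂ x)⁻¹‖ ≤ N / (1 - c * M) ^ 2 * |q₁ - q₂| by
    simpa only [sub_zero, abs_one, mul_one, Real.norm_eq_abs] using
      intervalIntegral.norm_integral_le_of_norm_le_const hbound
  intro x hx
  rw [uIoc_of_le zero_le_one] at hx
  have hx' := Ioc_subset_Icc_self hx
  have h₁ := one_sub_mul_le_profile_of_le hF hR hM hη hq₁ hx'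
  have h₂ := one_sub_mul_le_profile_of_le hF hR hM hη hq₂ hx'
  have hsub : profile F R η q₂ x - profile F R η q₁ x = R x * (q₂ - q₁) := by
    rw [profile, profile]
    ring
  rw [inv_sub_inv (hm.trans_le h₁).ne' (hm.trans_le h₂).ne', hsub, norm_div, norm_mul,
    Real.norm_of_nonneg (hR x hx'),
    Real.norm_of_nonneg (mul_pos (hm.trans_le h₁) (hm.trans_le h₂)).le, Real.norm_eq_abs,
    abs_sub_comm, div_mul_eq_mul_div, sq]
  exact div_le_div₀ (mul_nonneg ((hR x hx').trans (hN x hx')) (abs_nonneg _))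
    (mul_le_mul_of_nonneg_right (hN x hx') (abs_nonneg _)) (by positivity)
    (mul_le_mul h₁ h₂ hm.le (hm.le.trans h₁))

theorem exists_lipschitzWith_profileMass_pow (hc : c < 1 / M) (n : ℕ) :
    ∃ K : ℝ≥0, ∀ η ∈ Icc 0 c, LipschitzWith K fun q => profileMass F R η (max q 0) ^ n := by
  obtain ⟨N, hN⟩ := isCompact_Icc.exists_bound_of_continuousOn hcR
  have hRN : ∀ x ∈ Icc (0 : ℝ) 1, R x ≤ N := fun x hx => (le_abs_self _).trans (hN x hx)
  have hm := one_sub_mul_pos_of_lt_one_div hM hc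
  have hN₀ : 0 ≤ N := (hR 0 unitInterval.zero_mem).trans (hRN 0 unitInterval.zero_mem)
  refine ⟨Real.toNNReal (N / (1 - c * M) ^ 2 * n * (1 - c * M)⁻¹ ^ (n - 1)),
    fun η hη => LipschitzWith.of_dist_le_mul fun q₁ q₂ => ?_⟩
  have hη' : η ∈ Ico 0 (1 / M) := ⟨hη.1, hη.2.trans_lt hc⟩
  have hmass : ∀ q, |profileMass F R η (max q 0)| ≤ (1 - c * M)⁻¹ := fun q => by
    rw [abs_of_pos (profileMass_pos hcF hcR hF hR hM hη' (le_max_right _ _))]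
    exact profileMass_le_inv hcF hcR hF hR hM hc hη (le_max_right _ _)
  have hsub : |profileMass F R η (max q₁ 0) - profileMass F R η (max q₂ 0)|
      ≤ N / (1 - c * M) ^ 2 * |q₁ - q₂| :=
    (abs_profileMass_sub_le hcF hcR hF hR hM hRN hc hη (le_max_right _ _) (le_max_right _ _)).trans
      (mul_le_mul_of_nonneg_left (abs_max_sub_max_le_abs q₁ q₂ 0) (by positivity))
  rw [Real.coe_toNNReal _ (by positivity), Real.dist_eq, Real.dist_eq]
  calc _ ≤ _ := abs_pow_sub_pow_le _ _ n
    _ ≤ N / (1 - c * M) ^ 2 * |q₁ - q₂| * n * (1 - c * M)⁻¹ ^ (n - 1) := by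
        gcongr
        exact max_le (hmass q₁) (hmass q₂)
    _ = N / (1 - c * M) ^ 2 * n * (1 - c * M)⁻¹ ^ (n - 1) * |q₁ - q₂| := by ring

/-- The truncation `max q 0` keeps the field defined for all `q`; it is removed at the end since
`Q'' ≥ 0`. -/
theorem nonempty_profileWeight : Nonempty (ProfileWeight F R M) := by
  have hb : 0 < 1 / M := one_div_pos.2 hM
  obtain ⟨Q, Q₁, hQ0, hQ₁0, hQ, hQ₁⟩ := exists_second_order_solution
    (g := fun η q => profileMass F R η (max q 0) ^ 3) hb
    (fun c hc => exists_lipschitzWith_profileMass_pow hcF hcR hF hR hM hc 3)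
    (fun q => (continuousOn_profileMass hcF hcR hF hR hM Subset.rfl continuousOn_const
      fun _ _ => le_max_right q 0).pow 3)
    (fun c hc => by
      refine ⟨Real.toNNReal ((1 - c * M)⁻¹ ^ 3), fun η hη q => ?_⟩
      have hpos := profileMass_pos hcF hcR hF hR hM ⟨hη.1, hη.2.trans_lt hc⟩ (le_max_right q 0)
      have hle := profileMass_le_inv hcF hcR hF hR hM hc hη (le_max_right q 0)
      rw [Real.norm_of_nonneg (pow_pos hpos 3).le,
        Real.coe_toNNReal _ (pow_nonneg (hpos.le.trans hle) 3)]
      exact pow_le_pow_left₀ hpos.le hle 3)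
  have hnonneg : ∀ {u u' : ℝ → ℝ},
      (∀ η ∈ Ico 0 (1 / M), HasDerivWithinAt u (u' η) (Ico 0 (1 / M)) η) →
      (∀ η ∈ Ico 0 (1 / M), 0 ≤ u' η) → u 0 = 0 → ∀ η ∈ Ico 0 (1 / M), 0 ≤ u η :=
    fun {u u'} hu hu' hu0 η hη => hu0 ▸ monotoneOn_of_hasDerivWithinAt_nonneg (convex_Ico _ _)
      (fun s hs => (hu s hs).continuousWithinAt)
      (fun s hs => (hu s (interior_subset hs)).mono interior_subset)
      (fun s hs => hu' s (interior_subset hs)) (left_mem_Ico.2 hb) hη hη.1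
  have hQ_nonneg : ∀ η ∈ Ico 0 (1 / M), 0 ≤ Q η := hnonneg hQ (hnonneg hQ₁ (fun η hη =>
    pow_nonneg (profileMass_pos hcF hcR hF hR hM hη (le_max_right _ _)).le 3) hQ₁0) hQ0
  exact ⟨{ Q := Q, Q₁ := Q₁, cont_F := hcF, cont_R := hcR, F_le := hF, R_nonneg := hR, M_pos := hM,
           Q_zero := hQ0, Q₁_zero := hQ₁0, hasDerivWithinAt_Q := hQ,
           hasDerivWithinAt_Q₁ := fun η hη => by
             simpa only [max_eq_left (hQ_nonneg η hη)] using hQ₁ η hη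
           Q_nonneg := hQ_nonneg }⟩

end Profile

section TimeChange

variable {a b T : ℝ} {τ : ℝ → ℝ}

theorem image_Ico_of_strictMonoOn (hab : a < b) (hτ : ContinuousOn τ (Ico a b))
    (hmono : StrictMonoOn τ (Ico a b)) (hlim : Tendsto τ (𝓝[<] b) (𝓝 T)) :
    τ '' Ico a b = Ico (τ a) T := by
  have ha : a ∈ Ico a b := left_mem_Ico.2 hab
  refine Subset.antisymm ?_ ?_
  · rintro _ ⟨η, hη, rfl⟩
    obtain ⟨η', hlt, hη'b⟩ := exists_between hη.2
    have hη' : η' ∈ Ico a b := ⟨hη.1.trans hlt.le, hη'b⟩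
    have hle : τ η' ≤ T := ge_of_tendsto hlim <| by
      filter_upwards [Ioo_mem_nhdsLT hη'b] with s hs
      exact hmono.monotoneOn hη' ⟨hη'.1.trans hs.1.le, hs.2⟩ hs.1.le
    exact ⟨hmono.monotoneOn ha hη hη.1, (hmono hη hη' hlt).trans_le hle⟩
  · rintro t ⟨hat, htT⟩
    obtain ⟨η', htη', hη'⟩ :=
      ((hlim.eventually_const_lt htT).and (Ioo_mem_nhdsLT hab)).exists
    obtain ⟨η, hη, rfl⟩ := intermediate_value_Icc hη'.1.le
      (hτ.mono (Icc_subset_Ico_right hη'.2)) ⟨hat, htη'.le⟩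
    exact ⟨η, Icc_subset_Ico_right hη'.2 hη, rfl⟩

theorem exists_inverse_Ico_of_strictMonoOn (hab : a < b) (hτ : ContinuousOn τ (Ico a b))
    (hmono : StrictMonoOn τ (Ico a b)) (hlim : Tendsto τ (𝓝[<] b) (𝓝 T)) :
    ∃ S : ℝ → ℝ, MapsTo S (Ico (τ a) T) (Ico a b) ∧ (∀ t ∈ Ico (τ a) T, τ (S t) = t) ∧
      ContinuousOn S (Ico (τ a) T) ∧ Tendsto S (𝓝[<] T) (𝓝[<] b) := by
  have himage := image_Ico_of_strictMonoOn hab hτ hmono hlim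
  have hsurj : SurjOn τ (Ico a b) (Ico (τ a) T) := himage.ge
  have haT : τ a < T := (himage ▸ mem_image_of_mem τ (left_mem_Ico.2 hab)).2
  set S := Function.invFunOn τ (Ico a b)
  have hS : MapsTo S (Ico (τ a) T) (Ico a b) := hsurj.mapsTo_invFunOn
  have hτS : ∀ t ∈ Ico (τ a) T, τ (S t) = t := hsurj.rightInvOn_invFunOn
  refine ⟨S, hS, hτS, ?_, ?_⟩
  · exact ContinuousOn.uncurry_left (f := fun _ : Unit => S) () (mem_univ _)
      (continuousOn_inverse_of_strictMonoOn (S := univ) (g := fun _ => τ)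
        (fun _ _ => continuousOn_const) (fun _ _ => hmono) (fun _ _ => hS) fun _ _ => hτS)
  · have hmem : ∀ᶠ t in 𝓝[<] T, t ∈ Ico (τ a) T := Ico_mem_nhdsLT haT
    refine tendsto_nhdsWithin_iff.2 ⟨tendsto_order.2 ⟨fun c hc => ?_, fun c hc => ?_⟩,
      hmem.mono fun t ht => (hS ht).2⟩
    · have hca : max c a ∈ Ico a b := ⟨le_max_right _ _, max_lt hc hab⟩
      have hcT : τ (max c a) < T := (himage ▸ mem_image_of_mem τ hca).2
      filter_upwards [hmem, Ioo_mem_nhdsLT hcT] with t ht htc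
      exact (le_max_left c a).trans_lt
        ((hmono.lt_iff_lt hca (hS ht)).1 (htc.1.trans_eq (hτS t ht).symm))
    · exact hmem.mono fun t ht => (hS ht).2.trans hc

theorem exists_inverse_integral {g : ℝ → ℝ} (hb : 0 < b) (hg : ContinuousOn g (Ico 0 b))
    (hpos : ∀ η ∈ Ico 0 b, 0 < g η)
    (hlim : Tendsto (fun η => ∫ μ in (0 : ℝ)..η, g μ) (𝓝[<] b) (𝓝 T)) :
    0 < T ∧ ∃ S : ℝ → ℝ, S 0 = 0 ∧ MapsTo S (Ico 0 T) (Ico 0 b) ∧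
      MapsTo S (Ioo 0 T) (Ioo 0 b) ∧ ContinuousOn S (Ico 0 T) ∧
      (∀ t ∈ Ioo 0 T, HasDerivAt S (g (S t))⁻¹ t) ∧ Tendsto S (𝓝[<] T) (𝓝[<] b) := by
  set τ : ℝ → ℝ := fun η => ∫ μ in (0 : ℝ)..η, g μ
  have hτ0 : τ 0 = 0 := intervalIntegral.integral_same
  have hτ : ∀ η ∈ Ico 0 b, HasDerivWithinAt τ (g η) (Ico 0 b) η := fun η hη =>
    hasDerivWithinAt_integral_Ico hg hη
  have hcont : ContinuousOn τ (Ico 0 b) := fun η hη => (hτ η hη).continuousWithinAt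
  have hmono : StrictMonoOn τ (Ico 0 b) := strictMonoOn_of_hasDerivWithinAt_pos (convex_Ico 0 b)
    hcont (fun η hη => (hτ η (interior_subset hη)).mono interior_subset)
    fun η hη => hpos η (interior_subset hη)
  obtain ⟨S, hS, hτS, hScont, hSlim⟩ := exists_inverse_Ico_of_strictMonoOn hb hcont hmono hlim
  have hT : τ 0 ∈ Ico (τ 0) T :=
    image_Ico_of_strictMonoOn hb hcont hmono hlim ▸ mem_image_of_mem τ (left_mem_Ico.2 hb)
  rw [hτ0] at hS hτS hScont hT
  have hS0 : S 0 = 0 := hmono.injOn (hS hT) (left_mem_Ico.2 hb) ((hτS 0 hT).trans hτ0.symm)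
  have hSne : ∀ t ∈ Ioo 0 T, S t ≠ 0 := fun t ht h => by
    have := hτS t (Ioo_subset_Ico_self ht)
    rw [h, hτ0] at this
    exact ht.1.ne this
  refine ⟨hT.2, S, hS0, hS, fun t ht => ?_, hScont, fun t ht => ?_, hSlim⟩
  · have := hS (Ioo_subset_Ico_self ht)
    exact ⟨this.1.lt_of_ne' (hSne t ht), this.2⟩
  · have htI := Ioo_subset_Ico_self ht
    exact (hasDerivWithinAt_of_leftInverse hS (hScont t htI) htI (hτ _ (hS htI))
      (hpos _ (hS htI)).ne' hτS).hasDerivAt (Ico_mem_nhds ht.1 ht.2)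

end TimeChange

/-- The first time derivative of `φ(S(t)) u(S(t))`, where `S' = φ(S)⁻²`. -/
noncomputable def liouvilleDeriv (φ φ₁ u u₁ : ℝ) : ℝ :=
  (φ₁ * u + φ * u₁) / φ ^ 2

/-- The potential `I` for which the change of unknown and time `w(t) = φ(S(t)) u(S(t))`,
`S' = φ(S)⁻²`, turns `u'' = φ³ r` into `w'' + I w = r`. -/
noncomputable def liouvillePotential (φ φ₁ φ₂ : ℝ) : ℝ :=
  2 * φ₁ ^ 2 / φ ^ 6 - φ₂ / φ ^ 5

section Liouville

variable {φ φ₁ u u₁ S : ℝ → ℝ} {φ₂ r t : ℝ}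

theorem hasDerivAt_liouville (hS : HasDerivAt S (φ (S t) ^ 2)⁻¹ t)
    (hφ : HasDerivAt φ (φ₁ (S t)) (S t)) (hu : HasDerivAt u (u₁ (S t)) (S t)) :
    HasDerivAt (fun s => φ (S s) * u (S s))
      (liouvilleDeriv (φ (S t)) (φ₁ (S t)) (u (S t)) (u₁ (S t))) t :=
  (hφ.mul hu).comp t hS

theorem hasDerivAt_liouvilleDeriv (hS : HasDerivAt S (φ (S t) ^ 2)⁻¹ t) (h0 : φ (S t) ≠ 0)
    (hφ : HasDerivAt φ (φ₁ (S t)) (S t)) (hφ₁ : HasDerivAt φ₁ φ₂ (S t))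
    (hu : HasDerivAt u (u₁ (S t)) (S t)) (hu₁ : HasDerivAt u₁ (φ (S t) ^ 3 * r) (S t)) :
    HasDerivAt (fun s => liouvilleDeriv (φ (S s)) (φ₁ (S s)) (u (S s)) (u₁ (S s)))
      (r - liouvillePotential (φ (S t)) (φ₁ (S t)) φ₂ * (φ (S t) * u (S t))) t := by
  have hη : HasDerivAt (fun η => liouvilleDeriv (φ η) (φ₁ η) (u η) (u₁ η)) _ (S t) :=
    ((hφ₁.mul hu).add (hφ.mul hu₁)).div (hφ.pow 2) (pow_ne_zero 2 h0)
  refine (hη.comp t hS).congr_deriv ?_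
  simp only [liouvillePotential, Pi.mul_apply, Pi.add_apply]
  field_simp
  ring

theorem continuousOn_liouvilleDeriv {α : Type*} [TopologicalSpace α] {A : Set α}
    {φ φ₁ u u₁ : α → ℝ} (hφ : ContinuousOn φ A) (hφ₁ : ContinuousOn φ₁ A) (hu : ContinuousOn u A)
    (hu₁ : ContinuousOn u₁ A) (h0 : ∀ p ∈ A, φ p ≠ 0) :
    ContinuousOn (fun p => liouvilleDeriv (φ p) (φ₁ p) (u p) (u₁ p)) A :=
  ((hφ₁.mul hu).add (hφ.mul hu₁)).div (hφ.pow 2) fun p hp => pow_ne_zero 2 (h0 p hp)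

theorem continuousOn_liouvillePotential {α : Type*} [TopologicalSpace α] {A : Set α}
    {φ φ₁ φ₂ : α → ℝ} (hφ : ContinuousOn φ A) (hφ₁ : ContinuousOn φ₁ A) (hφ₂ : ContinuousOn φ₂ A)
    (h0 : ∀ p ∈ A, φ p ≠ 0) :
    ContinuousOn (fun p => liouvillePotential (φ p) (φ₁ p) (φ₂ p)) A :=
  (((hφ₁.pow 2).const_mul 2).div (hφ.pow 6) fun p hp => pow_ne_zero 6 (h0 p hp)).sub
    (hφ₂.div (hφ.pow 5) fun p hp => pow_ne_zero 5 (h0 p hp))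

end Liouville

theorem continuousOn_comp_time {E : Type*} [TopologicalSpace E] {J K A : Set ℝ} {S : ℝ → ℝ}
    {k : ℝ → ℝ → E} (hk : ContinuousOn (fun p : ℝ × ℝ => k p.1 p.2) (K ×ˢ A)) (hS : MapsTo S J K)
    (hcS : ContinuousOn S J) : ContinuousOn (fun p : ℝ × ℝ => k (S p.1) p.2) (J ×ˢ A) :=
  hk.comp ((hcS.comp continuousOn_fst fun _ hp => hp.1).prodMk continuousOn_snd)
    fun _ hp => ⟨hS hp.1, hp.2⟩

namespace ProfileWeight

variable {F R : ℝ → ℝ} {M η x T : ℝ}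

/-- The profile along the weight `Q`. -/
noncomputable def D (P : ProfileWeight F R M) (η x : ℝ) : ℝ :=
  profile F R η (P.Q η) x

/-- The derivative of `D` in `η`. -/
noncomputable def Dη (P : ProfileWeight F R M) (η x : ℝ) : ℝ :=
  -F x + P.Q₁ η * R x

/-- The derivative of `D` in `x`. -/
noncomputable def Dx (P : ProfileWeight F R M) (η x : ℝ) : ℝ :=
  -(η * dX F x) + P.Q η * dX R x

/-- The mixed derivative of `D`. -/
noncomputable def Dηx (P : ProfileWeight F R M) (η x : ℝ) : ℝ :=
  -dX F x + P.Q₁ η * dX R x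

/-- The mass `φ = ∫₀¹ dx / D` along the weight `Q`. -/
noncomputable def mass (P : ProfileWeight F R M) (η : ℝ) : ℝ :=
  profileMass F R η (P.Q η)

/-- The first derivative of `mass`. -/
noncomputable def mass₁ (P : ProfileWeight F R M) (η : ℝ) : ℝ :=
  ∫ x in (0 : ℝ)..1, -P.Dη η x / P.D η x ^ 2

/-- The second derivative of `mass`, with `D_ηη = Q'' R = mass³ R`. -/
noncomputable def mass₂ (P : ProfileWeight F R M) (η : ℝ) : ℝ :=
  ∫ x in (0 : ℝ)..1, (2 * P.Dη η x ^ 2 / P.D η x ^ 3 - P.mass η ^ 3 * R x / P.D η x ^ 2)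

theorem continuousOn_Q (P : ProfileWeight F R M) : ContinuousOn P.Q (Ico 0 (1 / M)) :=
  fun η hη => (P.hasDerivWithinAt_Q η hη).continuousWithinAt

theorem continuousOn_Q₁ (P : ProfileWeight F R M) : ContinuousOn P.Q₁ (Ico 0 (1 / M)) :=
  fun η hη => (P.hasDerivWithinAt_Q₁ η hη).continuousWithinAt

theorem continuousOn_D (P : ProfileWeight F R M) :
    ContinuousOn (fun p : ℝ × ℝ => P.D p.1 p.2) (Ico 0 (1 / M) ×ˢ Icc 0 1) :=
  continuousOn_profile P.cont_F P.cont_R P.continuousOn_Q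

theorem continuousOn_Dη (P : ProfileWeight F R M) :
    ContinuousOn (fun p : ℝ × ℝ => P.Dη p.1 p.2) (Ico 0 (1 / M) ×ˢ Icc 0 1) :=
  (P.cont_F.comp continuousOn_snd fun _ hp => hp.2).neg.add
    ((P.continuousOn_Q₁.comp continuousOn_fst fun _ hp => hp.1).mul
      (P.cont_R.comp continuousOn_snd fun _ hp => hp.2))

theorem continuousOn_Dx (P : ProfileWeight F R M) (hF' : ContinuousOn (dX F) (Icc 0 1))
    (hR' : ContinuousOn (dX R) (Icc 0 1)) :
    ContinuousOn (fun p : ℝ × ℝ => P.Dx p.1 p.2) (Ico 0 (1 / M) ×ˢ Icc 0 1) :=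
  (continuousOn_fst.mul (hF'.comp continuousOn_snd fun _ hp => hp.2)).neg.add
    ((P.continuousOn_Q.comp continuousOn_fst fun _ hp => hp.1).mul
      (hR'.comp continuousOn_snd fun _ hp => hp.2))

theorem continuousOn_Dηx (P : ProfileWeight F R M) (hF' : ContinuousOn (dX F) (Icc 0 1))
    (hR' : ContinuousOn (dX R) (Icc 0 1)) :
    ContinuousOn (fun p : ℝ × ℝ => P.Dηx p.1 p.2) (Ico 0 (1 / M) ×ˢ Icc 0 1) :=
  (hF'.comp continuousOn_snd fun _ hp => hp.2).neg.add
    ((P.continuousOn_Q₁.comp continuousOn_fst fun _ hp => hp.1).mul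
      (hR'.comp continuousOn_snd fun _ hp => hp.2))

theorem D_pos (P : ProfileWeight F R M) (hη : η ∈ Ico 0 (1 / M)) (hx : x ∈ Icc (0 : ℝ) 1) :
    0 < P.D η x :=
  profile_pos P.F_le P.R_nonneg P.M_pos hη (P.Q_nonneg η hη) hx

theorem hasDerivAt_D (P : ProfileWeight F R M) (hη : η ∈ Ioo 0 (1 / M)) :
    HasDerivAt (fun η => P.D η x) (P.Dη η x) η := by
  have hQ := (P.hasDerivWithinAt_Q η (Ioo_subset_Ico_self hη)).hasDerivAt
    (Ico_mem_nhds hη.1 hη.2)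
  exact (((hasDerivAt_id η).mul_const (F x)).const_sub 1 |>.add (hQ.mul_const (R x))).congr_deriv
    (by rw [one_mul, Dη])

theorem hasDerivAt_Dη (P : ProfileWeight F R M) (hη : η ∈ Ioo 0 (1 / M)) :
    HasDerivAt (fun η => P.Dη η x) (P.mass η ^ 3 * R x) η :=
  (((P.hasDerivWithinAt_Q₁ η (Ioo_subset_Ico_self hη)).hasDerivAt
    (Ico_mem_nhds hη.1 hη.2)).mul_const (R x)).const_add (-F x)

theorem hasDerivWithinAt_D (P : ProfileWeight F R M) (hF : DifferentiableOn ℝ F (Icc 0 1))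
    (hR : DifferentiableOn ℝ R (Icc 0 1)) (hx : x ∈ Icc (0 : ℝ) 1) :
    HasDerivWithinAt (P.D η) (P.Dx η x) (Icc 0 1) x :=
  (((hF x hx).hasDerivWithinAt.const_mul η).const_sub 1).add
    ((hR x hx).hasDerivWithinAt.const_mul (P.Q η))

theorem hasDerivWithinAt_Dη (P : ProfileWeight F R M) (hF : DifferentiableOn ℝ F (Icc 0 1))
    (hR : DifferentiableOn ℝ R (Icc 0 1)) (hx : x ∈ Icc (0 : ℝ) 1) :
    HasDerivWithinAt (P.Dη η) (P.Dηx η x) (Icc 0 1) x :=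
  (hF x hx).hasDerivWithinAt.neg.add ((hR x hx).hasDerivWithinAt.const_mul (P.Q₁ η))

theorem continuousOn_mass (P : ProfileWeight F R M) : ContinuousOn P.mass (Ico 0 (1 / M)) :=
  continuousOn_profileMass P.cont_F P.cont_R P.F_le P.R_nonneg P.M_pos Subset.rfl P.continuousOn_Q
    P.Q_nonneg

theorem mass_pos (P : ProfileWeight F R M) (hη : η ∈ Ico 0 (1 / M)) : 0 < P.mass η :=
  profileMass_pos P.cont_F P.cont_R P.F_le P.R_nonneg P.M_pos hη (P.Q_nonneg η hη)

theorem continuousOn_massCube_mul (P : ProfileWeight F R M) :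
    ContinuousOn (fun p : ℝ × ℝ => P.mass p.1 ^ 3 * R p.2) (Ico 0 (1 / M) ×ˢ Icc 0 1) :=
  ((P.continuousOn_mass.pow 3).comp continuousOn_fst fun _ hp => hp.1).mul
    (P.cont_R.comp continuousOn_snd fun _ hp => hp.2)

theorem continuousOn_mass₁ (P : ProfileWeight F R M) : ContinuousOn P.mass₁ (Ico 0 (1 / M)) :=
  continuousOn_parametric_integral_of_mem (h := fun η x => -P.Dη η x / P.D η x ^ 2)
    (P.continuousOn_Dη.neg.div (P.continuousOn_D.pow 2) fun _ hp =>
      pow_ne_zero 2 (P.D_pos hp.1 hp.2).ne') unitInterval.one_mem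

theorem continuousOn_mass₂ (P : ProfileWeight F R M) : ContinuousOn P.mass₂ (Ico 0 (1 / M)) := by
  have hpow : ∀ n, ∀ p ∈ Ico 0 (1 / M) ×ˢ Icc (0 : ℝ) 1, P.D p.1 p.2 ^ n ≠ 0 := fun n p hp =>
    pow_ne_zero n (P.D_pos hp.1 hp.2).ne'
  exact continuousOn_parametric_integral_of_mem
    (h := fun η x => 2 * P.Dη η x ^ 2 / P.D η x ^ 3 - P.mass η ^ 3 * R x / P.D η x ^ 2)
    ((((P.continuousOn_Dη.pow 2).const_mul 2).div (P.continuousOn_D.pow 3) (hpow 3)).sub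
      (P.continuousOn_massCube_mul.div (P.continuousOn_D.pow 2) (hpow 2))) unitInterval.one_mem

theorem hasDerivAt_mass (P : ProfileWeight F R M) (hη : η ∈ Ioo 0 (1 / M)) :
    HasDerivAt P.mass (P.mass₁ η) η := by
  have hsub : Ioo 0 (1 / M) ×ˢ Icc (0 : ℝ) 1 ⊆ Ico 0 (1 / M) ×ˢ Icc 0 1 :=
    prod_mono_left Ioo_subset_Ico_self
  exact hasDerivAt_integral_inv isOpen_Ioo (P.continuousOn_D.mono hsub)
    (P.continuousOn_Dη.mono hsub) (fun _ hη _ hx => (P.D_pos (Ioo_subset_Ico_self hη) hx).ne')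
    (fun _ hη _ _ => P.hasDerivAt_D hη) hη unitInterval.one_mem

theorem hasDerivAt_mass₁ (P : ProfileWeight F R M) (hη : η ∈ Ioo 0 (1 / M)) :
    HasDerivAt P.mass₁ (P.mass₂ η) η := by
  have hsub : Ioo 0 (1 / M) ×ˢ Icc (0 : ℝ) 1 ⊆ Ico 0 (1 / M) ×ˢ Icc 0 1 :=
    prod_mono_left Ioo_subset_Ico_self
  exact hasDerivAt_integral_neg_div_sq isOpen_Ioo (P.continuousOn_D.mono hsub)
    (P.continuousOn_Dη.mono hsub) (P.continuousOn_massCube_mul.mono hsub)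
    (fun _ hη _ hx => (P.D_pos (Ioo_subset_Ico_self hη) hx).ne')
    (fun _ hη _ _ => P.hasDerivAt_D hη) (fun _ hη _ _ => P.hasDerivAt_Dη hη) hη
    unitInterval.one_mem

theorem D_zero (P : ProfileWeight F R M) (x : ℝ) : P.D 0 x = 1 := by
  rw [D, profile, P.Q_zero, zero_mul, zero_mul, sub_zero, add_zero]

theorem Dη_zero (P : ProfileWeight F R M) (x : ℝ) : P.Dη 0 x = -F x := by
  rw [Dη, P.Q₁_zero, zero_mul, add_zero]

theorem mass_zero (P : ProfileWeight F R M) : P.mass 0 = 1 := by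
  change ∫ x in (0 : ℝ)..1, (P.D 0 x)⁻¹ = 1
  simp only [P.D_zero, inv_one, intervalIntegral.integral_const, sub_zero, smul_eq_mul, mul_one]

theorem mass₁_zero (P : ProfileWeight F R M) (hmean : ∫ x in (0 : ℝ)..1, F x = 0) :
    P.mass₁ 0 = 0 := by
  simp only [mass₁, P.D_zero, P.Dη_zero, neg_neg, one_pow, div_one, hmean]

theorem continuousOn_mass_mul (P : ProfileWeight F R M) {k : ℝ → ℝ → ℝ}
    (hk : ContinuousOn (fun p : ℝ × ℝ => k p.1 p.2) (Ico 0 (1 / M) ×ˢ Icc 0 1)) :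
    ContinuousOn (fun p : ℝ × ℝ => P.mass p.1 * k p.1 p.2) (Ico 0 (1 / M) ×ˢ Icc 0 1) :=
  (P.continuousOn_mass.comp continuousOn_fst fun _ hp => hp.1).mul hk

theorem continuousOn_liouvilleDeriv_mass (P : ProfileWeight F R M) {k k₁ : ℝ → ℝ → ℝ}
    (hk : ContinuousOn (fun p : ℝ × ℝ => k p.1 p.2) (Ico 0 (1 / M) ×ˢ Icc 0 1))
    (hk₁ : ContinuousOn (fun p : ℝ × ℝ => k₁ p.1 p.2) (Ico 0 (1 / M) ×ˢ Icc 0 1)) :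
    ContinuousOn (fun p : ℝ × ℝ => liouvilleDeriv (P.mass p.1) (P.mass₁ p.1) (k p.1 p.2)
      (k₁ p.1 p.2)) (Ico 0 (1 / M) ×ˢ Icc 0 1) :=
  continuousOn_liouvilleDeriv (φ := fun p : ℝ × ℝ => P.mass p.1) (φ₁ := fun p => P.mass₁ p.1)
    (P.continuousOn_mass.comp continuousOn_fst fun _ hp => hp.1)
    (P.continuousOn_mass₁.comp continuousOn_fst fun _ hp => hp.1) hk hk₁
    fun _ hp => (P.mass_pos hp.1).ne'

/-- The normalized profile `mass · D` solves the Lagrangian problem in the time `t` with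
`dt = mass² dη`. -/
noncomputable def reciprocalJacobian (P : ProfileWeight F R M)
    (hF : DifferentiableOn ℝ F (Icc 0 1)) (hF' : ContinuousOn (dX F) (Icc 0 1))
    (hR : DifferentiableOn ℝ R (Icc 0 1)) (hR' : ContinuousOn (dX R) (Icc 0 1))
    (hmean : ∫ x in (0 : ℝ)..1, F x = 0) {S : ℝ → ℝ} (hS0 : S 0 = 0)
    (hS : MapsTo S (Ico 0 T) (Ico 0 (1 / M))) (hS' : MapsTo S (Ioo 0 T) (Ioo 0 (1 / M)))
    (hcS : ContinuousOn S (Ico 0 T))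
    (hdS : ∀ t ∈ Ioo 0 T, HasDerivAt S (P.mass (S t) ^ 2)⁻¹ t) : ReciprocalJacobian F R T where
  W t x := P.mass (S t) * P.D (S t) x
  Wt t x := liouvilleDeriv (P.mass (S t)) (P.mass₁ (S t)) (P.D (S t) x) (P.Dη (S t) x)
  Wx t x := P.mass (S t) * P.Dx (S t) x
  Wtx t x := liouvilleDeriv (P.mass (S t)) (P.mass₁ (S t)) (P.Dx (S t) x) (P.Dηx (S t) x)
  I t := liouvillePotential (P.mass (S t)) (P.mass₁ (S t)) (P.mass₂ (S t))
  cont_W := continuousOn_comp_time (k := fun η x => P.mass η * P.D η x)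
    (P.continuousOn_mass_mul P.continuousOn_D) hS hcS
  cont_Wt := continuousOn_comp_time
    (k := fun η x => liouvilleDeriv (P.mass η) (P.mass₁ η) (P.D η x) (P.Dη η x))
    (P.continuousOn_liouvilleDeriv_mass P.continuousOn_D P.continuousOn_Dη) hS hcS
  cont_Wx := continuousOn_comp_time (k := fun η x => P.mass η * P.Dx η x)
    (P.continuousOn_mass_mul (P.continuousOn_Dx hF' hR')) hS hcS
  cont_Wtx := continuousOn_comp_time
    (k := fun η x => liouvilleDeriv (P.mass η) (P.mass₁ η) (P.Dx η x) (P.Dηx η x))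
    (P.continuousOn_liouvilleDeriv_mass (P.continuousOn_Dx hF' hR')
      (P.continuousOn_Dηx hF' hR')) hS hcS
  cont_I := (continuousOn_liouvillePotential P.continuousOn_mass P.continuousOn_mass₁
    P.continuousOn_mass₂ fun _ hη => (P.mass_pos hη).ne').comp (hcS.mono Ioo_subset_Ico_self)
      fun _ ht => hS (Ioo_subset_Ico_self ht)
  cont_R := P.cont_R
  hasDerivAt_W t ht x _ :=
    hasDerivAt_liouville (u := fun η => P.D η x) (u₁ := fun η => P.Dη η x) (hdS t ht)
      (P.hasDerivAt_mass (hS' ht)) (P.hasDerivAt_D (hS' ht))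
  hasDerivAt_Wt t ht x _ :=
    hasDerivAt_liouvilleDeriv (u := fun η => P.D η x) (u₁ := fun η => P.Dη η x) (hdS t ht)
      (P.mass_pos (hS (Ioo_subset_Ico_self ht))).ne' (P.hasDerivAt_mass (hS' ht))
      (P.hasDerivAt_mass₁ (hS' ht)) (P.hasDerivAt_D (hS' ht)) (P.hasDerivAt_Dη (hS' ht))
  hasDerivWithinAt_W t _ x hx := (P.hasDerivWithinAt_D hF hR hx).const_mul _
  hasDerivWithinAt_Wt t _ x hx :=
    (((P.hasDerivWithinAt_D hF hR hx).const_mul _).add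
      ((P.hasDerivWithinAt_Dη hF hR hx).const_mul _)).div_const _
  W_zero x _ := by rw [hS0, P.mass_zero, P.D_zero, one_mul]
  Wt_zero x _ := by
    rw [hS0, P.mass_zero, P.mass₁_zero hmean, P.Dη_zero, liouvilleDeriv]
    ring
  W_pos t ht x hx := mul_pos (P.mass_pos (hS ht)) (P.D_pos (hS ht) hx)
  integral_inv_W t ht := by
    simp only [mul_inv]
    rw [intervalIntegral.integral_const_mul]
    exact inv_mul_cancel₀ (P.mass_pos (hS ht)).ne'

end ProfileWeight

section MaximumAtEndpoints

open Asymptotics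

theorem isBigO_principal_of_forall_isBigO_nhdsWithin {X E F : Type*} [TopologicalSpace X]
    [SeminormedAddCommGroup E] [SeminormedAddCommGroup F] {K : Set X} {f : X → E} {g : X → F}
    (hK : IsCompact K) (h : ∀ x ∈ K, f =O[𝓝[K] x] g) : f =O[𝓟 K] g := by
  refine hK.induction_on (p := fun s => f =O[𝓟 s] g) (by simp) (fun s t hst ht =>
    ht.mono (principal_mono.2 hst)) (fun s t hs ht => ?_) fun x hx => ?_
  · rw [← sup_principal]
    exact hs.sup ht
  · obtain ⟨C, hC⟩ := (h x hx).bound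
    exact ⟨_, hC, isBigO_principal.2 ⟨C, fun _ hy => hy⟩⟩

theorem isBigO_sub_of_hasDerivWithinAt_ne_zero {𝕜 E : Type*} [NontriviallyNormedField 𝕜]
    [NormedAddCommGroup E] [NormedSpace 𝕜 E] {F : 𝕜 → E} {F' : E} {x : 𝕜} {s : Set 𝕜}
    (hF : HasDerivWithinAt F F' s x) (hF' : F' ≠ 0) :
    (fun y => y - x) =O[𝓝[s] x] fun y => F y - F x :=
  (hF.isTheta_sub hF').isBigO_symm.comp_tendsto (k := fun y => (y, x))
    (tendsto_id.prodMk (tendsto_pure.2 (Eventually.of_forall fun _ => rfl)))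

theorem eq_or_eq_of_isMaxOn_Icc_of_derivWithin_ne_zero {F : ℝ → ℝ} {a b x : ℝ}
    (hx : x ∈ Icc a b) (hmax : IsMaxOn F (Icc a b) x) (hF' : derivWithin F (Icc a b) x ≠ 0) :
    x = a ∨ x = b := by
  by_contra! hne
  have hnhds : Icc a b ∈ 𝓝 x := Icc_mem_nhds (hx.1.lt_of_ne' hne.1) (hx.2.lt_of_ne hne.2)
  rw [derivWithin_of_mem_nhds hnhds] at hF'
  exact hF' (hmax.isLocalMax hnhds).deriv_eq_zero

theorem exists_mul_le_max_sub {F : ℝ → ℝ} {M : ℝ} (hF : DifferentiableOn ℝ F (Icc 0 1))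
    (hle : ∀ x ∈ Icc (0 : ℝ) 1, F x ≤ M) (hF' : ∀ x ∈ Icc (0 : ℝ) 1, F x = M → dX F x ≠ 0) :
    ∃ c > 0, ∀ x ∈ Icc (0 : ℝ) 1, c * (x * (1 - x)) ≤ M - F x := by
  have hlocal : ∀ x ∈ Icc (0 : ℝ) 1, (fun y => y * (1 - y)) =O[𝓝[Icc 0 1] x] fun y => M - F y := by
    intro x hx
    have hcF := (hF x hx).continuousWithinAt
    rcases (hle x hx).lt_or_eq with hlt | rfl
    · have hcy : ContinuousWithinAt (fun y : ℝ => y * (1 - y)) (Icc 0 1) x := by fun_prop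
      have hpos : ∀ᶠ y in 𝓝[Icc 0 1] x, F y < M := hcF.eventually_lt_const hlt
      exact isBigO_of_div_tendsto_nhds (hpos.mono fun y hy h => absurd h (sub_pos.2 hy).ne') _
        (hcy.div (continuousWithinAt_const.sub hcF) (sub_pos.2 hlt).ne').tendsto
    · have hdist : (fun y => y * (1 - y)) =O[𝓝[Icc 0 1] x] fun y => y - x := by
        refine IsBigO.of_bound 1 (eventually_mem_nhdsWithin.mono fun y hy => ?_)
        rw [one_mul, Real.norm_of_nonneg (mul_nonneg hy.1 (sub_nonneg.2 hy.2)), Real.norm_eq_abs]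
        rcases eq_or_eq_of_isMaxOn_Icc_of_derivWithin_ne_zero hx hle (hF' x hx rfl) with rfl | rfl
        · rw [sub_zero, abs_of_nonneg hy.1]
          exact mul_le_of_le_one_right hy.1 (sub_le_self 1 hy.1)
        · rw [abs_sub_comm, abs_of_nonneg (sub_nonneg.2 hy.2)]
          exact mul_le_of_le_one_left (sub_nonneg.2 hy.2) hy.2
      refine (hdist.trans
        (isBigO_sub_of_hasDerivWithinAt_ne_zero (hF x hx).hasDerivWithinAt (hF' x hx rfl))).trans ?_
      simpa only [neg_sub] using (isBigO_refl (fun y => F y - F x) _).neg_right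
  obtain ⟨C, hC, hbound⟩ :=
    (isBigO_principal_of_forall_isBigO_nhdsWithin isCompact_Icc hlocal).exists_pos
  refine ⟨C⁻¹, inv_pos.2 hC, fun x hx => ?_⟩
  have h := isBigOWith_principal.1 hbound x hx
  rw [Real.norm_of_nonneg (mul_nonneg hx.1 (sub_nonneg.2 hx.2)),
    Real.norm_of_nonneg (sub_nonneg.2 (hle x hx))] at h
  exact (inv_mul_le_iff₀ hC).2 h

end MaximumAtEndpoints

section MassGrowth

theorem min_mul_le_one_sub_mul {F M w c μ : ℝ} (hM : 0 < M) (hμ : μ ∈ Ico 0 (1 / M)) (hw : 0 ≤ w)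
    (hw1 : w ≤ 1) (hF : c * w ≤ M - F) : min 1 (c / M) * w ≤ 1 - μ * F := by
  set e := min 1 (c / M)
  have he : e ≤ 1 := min_le_left _ _
  have heM : e * M ≤ c := (le_div_iff₀ hM).1 (min_le_right _ _)
  have hgap : 0 ≤ 1 - μ * M := (one_sub_mul_pos_of_lt_one_div hM hμ.2).le
  calc e * w = (1 - μ * M) * (e * w) + μ * (e * M * w) := by ring
    _ ≤ (1 - μ * M) * 1 + μ * (M - F) :=
        add_le_add (mul_le_mul_of_nonneg_left (mul_le_one₀ he hw hw1) hgap)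
          (mul_le_mul_of_nonneg_left ((mul_le_mul_of_nonneg_right heM hw).trans hF) hμ.1)
    _ = 1 - μ * F := by ring

theorem intervalIntegrable_rpow_mul_rpow_one_sub {u v : ℝ} (hu : 0 < u) (hv : 0 < v) :
    IntervalIntegrable (fun x : ℝ => x ^ (u - 1) * (1 - x) ^ (v - 1)) volume 0 1 := by
  have h := Complex.betaIntegral_convergent (u := u) (v := v) (by simpa) (by simpa)
  rw [intervalIntegrable_iff_integrableOn_Ioc_of_le zero_le_one] at h ⊢
  have hre : IntegrableOn (fun x : ℝ => RCLike.re ((x : ℂ) ^ ((u : ℂ) - 1) *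
      (1 - (x : ℂ)) ^ ((v : ℂ) - 1))) (Ioc 0 1) := Integrable.re h
  refine hre.congr_fun (fun x hx => ?_) measurableSet_Ioc
  have hx1 : (0 : ℝ) ≤ 1 - x := sub_nonneg.2 hx.2
  simp only [← Complex.ofReal_one, ← Complex.ofReal_sub, ← Complex.ofReal_cpow hx.1.le,
    ← Complex.ofReal_cpow hx1, ← Complex.ofReal_mul, RCLike.re_to_complex, Complex.ofReal_re]

theorem one_div_le_rpow_mul_rpow {a b d q : ℝ} (ha : 0 < a) (hb : 0 < b) (had : a ≤ d)
    (hbd : b ≤ d) (hq : 0 ≤ q) (hq1 : q ≤ 1) : 1 / d ≤ a ^ (q - 1) * b ^ (-q) := by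
  have hd : 0 < d := ha.trans_le had
  calc 1 / d = d ^ (q - 1) * d ^ (-q) := by
        rw [← Real.rpow_add hd, show q - 1 + -q = -1 by ring, Real.rpow_neg_one, one_div]
    _ ≤ a ^ (q - 1) * b ^ (-q) := by
        gcongr ?_ * ?_
        · exact Real.rpow_le_rpow_of_nonpos ha had (sub_nonpos.2 hq1)
        · exact Real.rpow_le_rpow_of_nonpos hb hbd (neg_nonpos.2 hq)

theorem exists_integral_one_div_le_rpow {F : ℝ → ℝ} {M c q : ℝ} (hcF : ContinuousOn F (Icc 0 1))
    (hM : 0 < M) (hle : ∀ x ∈ Icc (0 : ℝ) 1, F x ≤ M) (hc : 0 < c)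
    (hgap : ∀ x ∈ Icc (0 : ℝ) 1, c * (x * (1 - x)) ≤ M - F x) (hq : 0 < q) (hq1 : q ≤ 1) :
    ∃ C, ∀ μ ∈ Ico 0 (1 / M), ∫ x in (0 : ℝ)..1, 1 / (1 - μ * F x) ≤ C * (1 - μ * M) ^ (-q) := by
  set e := min 1 (c / M)
  have he : 0 < e := lt_min one_pos (div_pos hc hM)
  refine ⟨∫ x in (0 : ℝ)..1, e ^ (q - 1) * (x ^ (q - 1) * (1 - x) ^ (q - 1)), fun μ hμ => ?_⟩
  have hM' : 0 < 1 - μ * M := one_sub_mul_pos_of_lt_one_div hM hμ.2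
  have hden : ∀ x ∈ Icc (0 : ℝ) 1, 1 - μ * M ≤ 1 - μ * F x := fun x hx =>
    sub_le_sub_left (mul_le_mul_of_nonneg_left (hle x hx) hμ.1) 1
  rw [← intervalIntegral.integral_mul_const]
  refine intervalIntegral.integral_mono_on_of_le_Ioo zero_le_one
    ((continuousOn_const.div (continuousOn_const.sub (hcF.const_mul μ)) fun x hx =>
      (hM'.trans_le (hden x hx)).ne').intervalIntegrable_of_Icc zero_le_one)
    (((intervalIntegrable_rpow_mul_rpow_one_sub hq hq).const_mul _).mul_const _) fun x hx => ?_
  have hx1 : 0 < 1 - x := sub_pos.2 hx.2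
  have hxI := Ioo_subset_Icc_self hx
  have hlow : e * (x * (1 - x)) ≤ 1 - μ * F x :=
    min_mul_le_one_sub_mul hM hμ (mul_pos hx.1 hx1).le
      (mul_le_one₀ hx.2.le hx1.le (sub_le_self 1 hx.1.le)) (hgap x hxI)
  rw [← Real.mul_rpow hx.1.le hx1.le, ← Real.mul_rpow he.le (mul_pos hx.1 hx1).le]
  exact one_div_le_rpow_mul_rpow (mul_pos he (mul_pos hx.1 hx1)) hM' hlow (hden x hxI) hq.le hq1

theorem intervalIntegrable_one_sub_mul_rpow {M r : ℝ} (hr : -1 < r) :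
    IntervalIntegrable (fun μ : ℝ => (1 - μ * M) ^ r) volume 0 (1 / M) := by
  have h := ((intervalIntegral.intervalIntegrable_rpow' (a := 1) (b := 0) hr).comp_sub_left
    1).comp_mul_right (c := M)
  simpa only [sub_self, sub_zero, zero_div] using h

theorem intervalIntegrable_sq_of_le_rpow {φ : ℝ → ℝ} {M C q : ℝ} (hM : 0 < M) (hq : q < 1 / 2)
    (hcont : ContinuousOn φ (Ico 0 (1 / M))) (hφ : ∀ μ ∈ Ico 0 (1 / M), 0 ≤ φ μ)
    (hle : ∀ μ ∈ Ico 0 (1 / M), φ μ ≤ C * (1 - μ * M) ^ (-q)) :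
    IntervalIntegrable (fun μ => φ μ ^ 2) volume 0 (1 / M) := by
  have hdom : IntervalIntegrable (fun μ : ℝ => C ^ 2 * (1 - μ * M) ^ (-q * 2)) volume 0 (1 / M) :=
    (intervalIntegrable_one_sub_mul_rpow (by linarith)).const_mul _
  have hb : (0 : ℝ) ≤ 1 / M := by positivity
  rw [intervalIntegrable_iff_integrableOn_Ioo_of_le hb] at hdom ⊢
  refine Integrable.mono' hdom (((hcont.mono Ioo_subset_Ico_self).pow 2).aestronglyMeasurable
    measurableSet_Ioo) (ae_restrict_of_forall_mem measurableSet_Ioo fun μ hμ => ?_)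
  have hμ' := Ioo_subset_Ico_self hμ
  have hgap : 0 ≤ 1 - μ * M := (one_sub_mul_pos_of_lt_one_div hM hμ.2).le
  rw [Real.norm_of_nonneg (sq_nonneg _), Real.rpow_mul hgap, Real.rpow_two, ← mul_pow]
  exact pow_le_pow_left₀ (hφ μ hμ') (hle μ hμ') 2

theorem tendsto_one_sub_mul_mul_of_le_rpow {φ : ℝ → ℝ} {M C q : ℝ} (hM : 0 < M) (hq : q < 1)
    (hφ : ∀ μ ∈ Ico 0 (1 / M), 0 ≤ φ μ)
    (hle : ∀ μ ∈ Ico 0 (1 / M), φ μ ≤ C * (1 - μ * M) ^ (-q)) :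
    Tendsto (fun η => φ η * (1 - η * M)) (𝓝[<] (1 / M)) (𝓝 0) := by
  have hlim : Tendsto (fun η => C * (1 - η * M) ^ (1 - q)) (𝓝[<] (1 / M)) (𝓝 0) := by
    have hc : Continuous fun η : ℝ => C * (1 - η * M) ^ (1 - q) :=
      continuous_const.mul ((continuous_const.sub (continuous_mul_const M)).rpow_const
        fun _ => Or.inr (sub_pos.2 hq).le)
    refine (hc.tendsto' (1 / M) 0 ?_).mono_left nhdsWithin_le_nhds
    rw [one_div_mul_cancel hM.ne', sub_self, Real.zero_rpow (sub_pos.2 hq).ne', mul_zero]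
  have hmem : ∀ᶠ η in 𝓝[<] (1 / M), η ∈ Ico 0 (1 / M) := Ico_mem_nhdsLT (one_div_pos.2 hM)
  refine squeeze_zero' (hmem.mono fun η hη => ?_) (hmem.mono fun η hη => ?_) hlim
  · exact mul_nonneg (hφ η hη) (one_sub_mul_pos_of_lt_one_div hM hη.2).le
  · have hgap := one_sub_mul_pos_of_lt_one_div hM hη.2
    calc φ η * (1 - η * M) ≤ C * (1 - η * M) ^ (-q) * (1 - η * M) :=
          mul_le_mul_of_nonneg_right (hle η hη) hgap.le
      _ = C * (1 - η * M) ^ (1 - q) := by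
          rw [mul_assoc, ← Real.rpow_add_one hgap.ne', neg_add_eq_sub]

theorem tendsto_integral_nhdsLT {E : Type*} [NormedAddCommGroup E] [NormedSpace ℝ E] {g : ℝ → E}
    {a b : ℝ} (hab : a < b) (hg : IntervalIntegrable g volume a b) :
    Tendsto (fun η => ∫ μ in a..η, g μ) (𝓝[<] b) (𝓝 (∫ μ in a..b, g μ)) := by
  have h := intervalIntegral.continuousOn_primitive_interval' hg left_mem_uIcc b right_mem_uIcc
  rw [uIcc_of_le hab.le] at h
  exact h.tendsto.mono_left (nhdsWithin_le_iff.2 (Icc_mem_nhdsLT hab))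

end MassGrowth

theorem profileMass_zero_right (F R : ℝ → ℝ) (η : ℝ) :
    profileMass F R η 0 = ∫ x in (0 : ℝ)..1, 1 / (1 - η * F x) := by
  simp only [profileMass, profile, zero_mul, add_zero, one_div]

theorem ReciprocalJacobian.tendsto_integral_dX_velocity_atTop {F R : ℝ → ℝ} {T x : ℝ}
    (w : ReciprocalJacobian F R T) (hT : 0 < T) (hx : x = 0 ∨ x = 1)
    (hW : Tendsto (fun t => w.W t x) (𝓝[<] T) (𝓝 0)) :
    Tendsto (fun t => ∫ s in (0 : ℝ)..t, dX (w.velocity s) x) (𝓝[<] T) atTop := by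
  have hmem : ∀ᶠ t in 𝓝[<] T, t ∈ Ico 0 T := Ico_mem_nhdsLT hT
  have hxI : x ∈ Icc (0 : ℝ) 1 := by rcases hx with rfl | rfl <;> simp
  have hW' : Tendsto (fun t => w.W t x) (𝓝[<] T) (𝓝[>] 0) :=
    tendsto_nhdsWithin_iff.2 ⟨hW, hmem.mono fun t ht => w.W_pos t ht x hxI⟩
  exact (tendsto_neg_atBot_atTop.comp (Real.tendsto_log_nhdsGT_zero.comp hW')).congr'
    (hmem.mono fun t ht => (w.integral_dX_velocity_eq_neg_log ht hx).symm)

namespace ProfileWeight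

variable {F R : ℝ → ℝ} {M C q η : ℝ}

theorem mass_le_profileMass_zero (P : ProfileWeight F R M) (hη : η ∈ Ico 0 (1 / M)) :
    P.mass η ≤ profileMass F R η 0 := by
  have hint : ∀ {p}, 0 ≤ p → IntervalIntegrable (fun x => (profile F R η p x)⁻¹) volume 0 1 :=
    fun hp => (continuousOn_inv_profile_slice P.cont_F P.cont_R P.F_le P.R_nonneg P.M_pos hη
      hp).intervalIntegrable_of_Icc zero_le_one
  refine intervalIntegral.integral_mono_on zero_le_one (hint (P.Q_nonneg η hη)) (hint le_rfl)
    fun x hx => inv_anti₀ (profile_pos P.F_le P.R_nonneg P.M_pos hη le_rfl hx) ?_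
  rw [profile, profile, zero_mul]
  exact add_le_add_right (mul_nonneg (P.Q_nonneg η hη) (P.R_nonneg x hx)) _

theorem intervalIntegrable_profileMass_zero_sq (P : ProfileWeight F R M) (hq : q < 1 / 2)
    (hC : ∀ η ∈ Ico 0 (1 / M), profileMass F R η 0 ≤ C * (1 - η * M) ^ (-q)) :
    IntervalIntegrable (fun η => profileMass F R η 0 ^ 2) volume 0 (1 / M) :=
  intervalIntegrable_sq_of_le_rpow P.M_pos hq
    (continuousOn_profileMass P.cont_F P.cont_R P.F_le P.R_nonneg P.M_pos Subset.rfl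
      continuousOn_const fun _ _ => le_rfl)
    (fun _ hη => (profileMass_pos P.cont_F P.cont_R P.F_le P.R_nonneg P.M_pos hη le_rfl).le) hC

theorem intervalIntegrable_mass_sq (P : ProfileWeight F R M) (hq : q < 1 / 2)
    (hC : ∀ η ∈ Ico 0 (1 / M), profileMass F R η 0 ≤ C * (1 - η * M) ^ (-q)) :
    IntervalIntegrable (fun η => P.mass η ^ 2) volume 0 (1 / M) :=
  intervalIntegrable_sq_of_le_rpow P.M_pos hq P.continuousOn_mass (fun _ hη => (P.mass_pos hη).le)
    fun η hη => (P.mass_le_profileMass_zero hη).trans (hC η hη)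

theorem tendsto_mass_mul_D (P : ProfileWeight F R M) (hq : q < 1)
    (hC : ∀ η ∈ Ico 0 (1 / M), profileMass F R η 0 ≤ C * (1 - η * M) ^ (-q)) {x : ℝ}
    (hFx : F x = M) (hRx : R x = 0) :
    Tendsto (fun η => P.mass η * P.D η x) (𝓝[<] (1 / M)) (𝓝 0) := by
  simp only [D, profile, hFx, hRx, mul_zero, add_zero]
  exact tendsto_one_sub_mul_mul_of_le_rpow P.M_pos hq (fun _ hη => (P.mass_pos hη).le)
    fun η hη => (P.mass_le_profileMass_zero hη).trans (hC η hη)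

theorem exists_reciprocalJacobian (P : ProfileWeight F R M)
    (hF : DifferentiableOn ℝ F (Icc 0 1)) (hF' : ContinuousOn (dX F) (Icc 0 1))
    (hR : DifferentiableOn ℝ R (Icc 0 1)) (hR' : ContinuousOn (dX R) (Icc 0 1))
    (hmean : ∫ x in (0 : ℝ)..1, F x = 0) (hq : q < 1 / 2)
    (hC : ∀ η ∈ Ico 0 (1 / M), profileMass F R η 0 ≤ C * (1 - η * M) ^ (-q)) :
    ∃ T, 0 < T ∧ T ≤ ∫ η in (0 : ℝ)..1 / M, profileMass F R η 0 ^ 2 ∧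
      ∃ w : ReciprocalJacobian F R T,
        ∀ x, F x = M → R x = 0 → Tendsto (fun t => w.W t x) (𝓝[<] T) (𝓝 0) := by
  have hb : 0 < 1 / M := one_div_pos.2 P.M_pos
  have hint := P.intervalIntegrable_mass_sq hq hC
  obtain ⟨hT, S, hS0, hS, hS', hcS, hdS, hlim⟩ := exists_inverse_integral hb
    (P.continuousOn_mass.pow 2) (fun η hη => pow_pos (P.mass_pos hη) 2)
    (tendsto_integral_nhdsLT hb hint)
  refine ⟨_, hT, ?_, P.reciprocalJacobian hF hF' hR hR' hmean hS0 hS hS' hcS hdS,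
    fun x hFx hRx => (P.tendsto_mass_mul_D (by linarith) hC hFx hRx).comp hlim⟩
  refine intervalIntegral.integral_mono_on_of_le_Ioo hb.le hint
    (P.intervalIntegrable_profileMass_zero_sq hq hC) fun η hη => ?_
  have hη' := Ioo_subset_Ico_self hη
  exact pow_le_pow_left₀ (P.mass_pos hη').le (P.mass_le_profileMass_zero hη') 2

end ProfileWeight

theorem exists_profileMass_zero_le_rpow {F : ℝ → ℝ} (R : ℝ → ℝ) {M q : ℝ}
    (hF : DifferentiableOn ℝ F (Icc 0 1)) (hM : 0 < M) (hle : ∀ x ∈ Icc (0 : ℝ) 1, F x ≤ M)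
    (hF' : ∀ x ∈ Icc (0 : ℝ) 1, F x = M → dX F x ≠ 0) (hq : 0 < q) (hq1 : q ≤ 1) :
    ∃ C, ∀ η ∈ Ico 0 (1 / M), profileMass F R η 0 ≤ C * (1 - η * M) ^ (-q) := by
  obtain ⟨c, hc, hgap⟩ := exists_mul_le_max_sub hF hle hF'
  simp only [profileMass_zero_right]
  exact exists_integral_one_div_le_rpow hF.continuousOn hM hle hc hgap hq hq1

theorem integral_dX_eq_zero {u : ℝ → ℝ} (hu : DifferentiableOn ℝ u (Icc 0 1))
    (hu' : ContinuousOn (dX u) (Icc 0 1)) (h : u 0 = u 1) : ∫ x in (0 : ℝ)..1, dX u x = 0 := by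
  have hint := integral_eq_sub_of_hasDerivWithinAt_Icc (fun x hx => (hu x hx).hasDerivWithinAt) hu'
    unitInterval.one_mem
  rwa [← h, sub_self] at hint

theorem differentiableOn_and_continuousOn_dX {u : ℝ → ℝ} (hu : ContDiffOn ℝ 1 u (Icc 0 1)) :
    DifferentiableOn ℝ u (Icc 0 1) ∧ ContinuousOn (dX u) (Icc 0 1) :=
  (contDiffOn_one_iff_derivWithin (uniqueDiffOn_Icc zero_lt_one)).1 hu

theorem theorem3p2_general (f₀ ρ₀ : ℝ → ℝ) (M₀ : ℝ)
    (hf₀ : ContDiffOn ℝ 2 f₀ (Icc 0 1)) (hρ₀ : ContDiffOn ℝ 1 ρ₀ (Icc 0 1))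
    (hf₀_bdry : f₀ 0 = 0 ∧ f₀ 1 = 0) (hρ₀_bdry : ρ₀ 0 = 0 ∧ ρ₀ 1 = 0)
    (hρ₀_nonneg : ∀ x ∈ Icc (0 : ℝ) 1, 0 ≤ ρ₀ x)
    (hM₀ : IsGreatest (dX f₀ '' Icc 0 1) M₀) (hM₀_pos : 0 < M₀)
    (h_vort : ∀ x ∈ Icc (0 : ℝ) 1, dX f₀ x = M₀ → dX (dX f₀) x ≠ 0) :
    ∃ tstar : ℝ, 0 < tstar ∧
      (∃ L : ℝ,
        Tendsto (fun η : ℝ =>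
            ∫ μ in (0 : ℝ)..η, (∫ x in (0 : ℝ)..1, 1 / (1 - μ * dX f₀ x)) ^ 2)
          (𝓝[<] (1 / M₀)) (𝓝 L) ∧
        tstar ≤ L) ∧
      ∃ f ρ : ℝ → ℝ → ℝ, IsDirichletSolution f₀ ρ₀ tstar f ρ ∧
        (∀ (T : ℝ) (g σ : ℝ → ℝ → ℝ), IsDirichletSolution f₀ ρ₀ T g σ →
          T ≤ tstar ∧ ∀ t ∈ Ico 0 T, ∀ x ∈ Icc (0 : ℝ) 1, g t x = f t x ∧ σ t x = ρ t x) ∧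
        ∀ x ∈ Icc (0 : ℝ) 1, dX f₀ x = M₀ →
          Tendsto (fun t : ℝ => ∫ s in (0 : ℝ)..t, dX (f s) x) (𝓝[<] tstar) atTop := by
  have hF : ContDiffOn ℝ 1 (dX f₀) (Icc 0 1) :=
    hf₀.derivWithin (uniqueDiffOn_Icc zero_lt_one) (by norm_num)
  have hdf₀ := hf₀.differentiableOn two_ne_zero
  obtain ⟨hdF, hcF'⟩ := differentiableOn_and_continuousOn_dX hF
  obtain ⟨hdR, hcR'⟩ := differentiableOn_and_continuousOn_dX hρ₀
  have hle : ∀ x ∈ Icc (0 : ℝ) 1, dX f₀ x ≤ M₀ := fun x hx => hM₀.2 (mem_image_of_mem _ hx)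
  have hends : ∀ x ∈ Icc (0 : ℝ) 1, dX f₀ x = M₀ → x = 0 ∨ x = 1 := fun x hx hxM =>
    eq_or_eq_of_isMaxOn_Icc_of_derivWithin_ne_zero hx (fun y hy => hxM ▸ hle y hy) (h_vort x hx hxM)
  obtain ⟨P⟩ := nonempty_profileWeight hF.continuousOn hρ₀.continuousOn hle hρ₀_nonneg hM₀_pos
  obtain ⟨C, hC⟩ := exists_profileMass_zero_le_rpow ρ₀ (q := 1 / 4) hdF hM₀_pos hle h_vort
    (by norm_num) (by norm_num)
  have hq : (1 / 4 : ℝ) < 1 / 2 := by norm_num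
  obtain ⟨T, hT, hTL, w, hW⟩ := P.exists_reciprocalJacobian hdF hcF' hdR hcR'
    (integral_dX_eq_zero hdf₀ hF.continuousOn (hf₀_bdry.1.trans hf₀_bdry.2.symm)) hq hC
  have hsol := w.isDirichletSolution hT hdf₀ hF.continuousOn hf₀_bdry hdR hcR' hρ₀_bdry
  have hblow : ∀ x ∈ Icc (0 : ℝ) 1, dX f₀ x = M₀ →
      Tendsto (fun t => ∫ s in (0 : ℝ)..t, dX (w.velocity s) x) (𝓝[<] T) atTop :=
    fun x hx hxM => w.tendsto_integral_dX_velocity_atTop hT (hends x hx hxM) <|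
      hW x hxM (by rcases hends x hx hxM with rfl | rfl; exacts [hρ₀_bdry.1, hρ₀_bdry.2])
  have hL := tendsto_integral_nhdsLT (one_div_pos.2 hM₀_pos)
    (P.intervalIntegrable_profileMass_zero_sq hq hC)
  simp only [profileMass_zero_right] at hL hTL
  obtain ⟨x, hx, hxM⟩ := hM₀.1
  refine ⟨T, hT, ⟨_, hL, hTL⟩, w.velocity, w.density, hsol, fun T' g σ hg => ?_, hblow⟩
  have hT' := hsol.le_of_tendsto_integral_fx_atTop hT hx (hblow x hx hxM) hg
  exact ⟨hT', fun t ht y hy => hg.unique (hsol.mono hT') ht hy⟩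

theorem theorem3p2 (f₀ ρ₀ : ℝ → ℝ) (M₀ : ℝ)
    (hf₀ : ContDiffOn ℝ ∞ f₀ (Icc 0 1)) (hρ₀ : ContDiffOn ℝ ∞ ρ₀ (Icc 0 1))
    (hf₀_bdry : f₀ 0 = 0 ∧ f₀ 1 = 0) (hρ₀_bdry : ρ₀ 0 = 0 ∧ ρ₀ 1 = 0)
    (hρ₀_nonneg : ∀ x ∈ Icc (0 : ℝ) 1, 0 ≤ ρ₀ x)
    (hM₀ : IsGreatest (dX f₀ '' Icc 0 1) M₀) (hM₀_pos : 0 < M₀)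
    (h_only : ∀ x ∈ Icc (0 : ℝ) 1, dX f₀ x = M₀ → x = 0 ∨ x = 1)
    (h_vort : ∀ x ∈ Icc (0 : ℝ) 1, dX f₀ x = M₀ → dX (dX f₀) x ≠ 0) :
    ∃ tstar : ℝ, 0 < tstar ∧
      -- the explicit upper bound, the limit being finite
      (∃ L : ℝ,
        Tendsto (fun η : ℝ =>
            ∫ μ in (0 : ℝ)..η, (∫ x in (0 : ℝ)..1, 1 / (1 - μ * dX f₀ x)) ^ 2)
          (𝓝[<] (1 / M₀)) (𝓝 L) ∧
        tstar ≤ L) ∧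
      -- the solution exists on `[0, tstar)`, is unique, cannot be continued, and blows up
      ∃ f ρ : ℝ → ℝ → ℝ, IsDirichletSolution f₀ ρ₀ tstar f ρ ∧
        (∀ (T : ℝ) (g σ : ℝ → ℝ → ℝ), IsDirichletSolution f₀ ρ₀ T g σ →
          T ≤ tstar ∧ ∀ t ∈ Ico 0 T, ∀ x ∈ Icc (0 : ℝ) 1, g t x = f t x ∧ σ t x = ρ t x) ∧
        ∀ x ∈ Icc (0 : ℝ) 1, dX f₀ x = M₀ →
          Tendsto (fun t : ℝ => ∫ s in (0 : ℝ)..t, dX (f s) x) (𝓝[<] tstar) atTop :=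
  theorem3p2_general f₀ ρ₀ M₀ (contDiffOn_infty.1 hf₀ 2) (contDiffOn_infty.1 hρ₀ 1)
    hf₀_bdry hρ₀_bdry hρ₀_nonneg hM₀ hM₀_pos h_vort
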